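/- \textbf{Setup.} A server holds files of $F$ bits each, divided into $L\ge 1$ popularity levels; level $i$ has $N_i$ files. There are $K$ caches of $MF$ bits each ($M\ge 0$ real), arranged cyclically. For every level $i$ and every $k\in\{1,\dots,K\}$ there are exactly $U_i\ge 1$ users who access the $d_i$ cyclically consecutive caches $k,k+1,\dots,k+d_i-1$ and request a file of level $i$, where $1\le d_i\le K$. The caches are filled as functions of the files (and possibly of common randomness) before the requests are known; then, for each request vector, the server broadcasts a message of $RF$ bits, and each user must recover its requested file from the message and the $d_i$ caches it accesses. The pair $(R,M)$, $R\ge0$, is achievable if, for independent uniformly distributed files, there are strategies whose probability that some user fails tends to $0$ as $F\to\infty$, for every request vector. Let $R^*(M)=\inf\{R:(R,M)\text{ is achievable}\}$ and $D=\max_i d_i$. \textbf{Memory sharing.} For $0\le m\le N/d$ let $R^{\mathrm{SL}}(m,K,N,U,d)=U\min\{N/m,K\}\,(1-dm/N)$, with $N/0=\infty$. For a set $A$ of levels let $S_A=\sum_{i\in A}\sqrt{N_iU_i}$, $T_A=\sum_{i\in A}N_i/d_i$, $V_A=\sum_{i\in A}N_i/K$. A partition $(H,I,J)$ of the set of levels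 is $M$-feasible if, with $\tilde M=(M-T_J+V_I)/S_I$, \[ \begin{aligned} \tilde M&<\tfrac1K\sqrt{N_h/U_h} &&(h\in H),\\ \tfrac1K\sqrt{N_i/U_i}\le\tilde M&\le\left(\tfrac1{d_i}+\tfrac1K\right)\sqrt{N_i/U_i} &&(i\in I),\\ \left(\tfrac1{d_j}+\tfrac1K\right)\sqrt{N_j/U_j}&<\tilde M &&(j\in J), \end{aligned} \] and $I\ne\emptyset$; if $M>\sum_iN_i/d_i$, the partition with $H=I=\emptyset$ is also $M$-feasible (read $\tilde M=+\infty$). Given an $M$-feasible partition, level $i$ receives memory $m_i=0$ if $i\in H$, $m_i=\sqrt{N_iU_i}\,\tilde M-N_i/K$ if $i\in I$, and $m_i=N_i/d_i$ if $i\in J$. The rate of the memory-sharing scheme is $R^{\mathrm{MU}}(M)=\sum_{i=1}^L R^{\mathrm{SL}}(m_i,K,N_i,U_i,d_i)$. \textbf{Theorem.} Suppose that $N_i\ge KU_i$ for every level $i$, and that for any two distinct levels $i,j$ with $U_i/N_i\ge U_j/N_j$, \[ \sqrt{\frac{U_i/N_i}{U_j/N_j}}\ \ge\ 198\,D . \]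 Then for every $M\ge0$ an $M$-feasible partition exists, and for every $M$-feasible partition the rate of the resulting memory-sharing scheme satisfies \[ R^{\mathrm{MU}}(M)\ \le\ 9909\,D\,R^*(M). \] -/

import Mathlib

/-- Parameters of the multi-level, multi-user, multi-access caching setup with `L` popularity levels:
`K` caches and, for each level `i`, `N i` files, `U i` users per cache and access degree `d i`. -/
structure CachingSetup (L : ℕ) where
  K : ℕ
  N : Fin L → ℕ
  U : Fin L → ℕ
  d : Fin L → ℕ

namespace CachingSetup

variable {L : ℕ}

/-- The maximum access degree `D = max_i d_i`. -/
def D (P : CachingSetup L) : ℕ := Finset.univ.sup P.d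

/-- The integrality ranges of the parameters: at least one level, at least one user per cache for
each level, and every user accesses at least one and at most all of the caches. -/
def Valid (P : CachingSetup L) : Prop :=
  1 ≤ L ∧ (∀ i, 1 ≤ P.U i) ∧ ∀ i, 1 ≤ P.d i ∧ P.d i ≤ P.K

/-- In every level there are at least as many files as users. -/
def MoreFilesThanUsers (P : CachingSetup L) : Prop :=
  ∀ i, P.K * P.U i ≤ P.N i

/-- The popularity of a level: the number of users (per cache) per file. -/
noncomputable def popularity (P : CachingSetup L) (i : Fin L) : ℝ := (P.U i : ℝ) / P.N i

/-- No two distinct levels have similar popularities (level-separation factor `1 / 198`). -/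
def LevelsSeparated (P : CachingSetup L) : Prop :=
  ∀ i j, i ≠ j → P.popularity j ≤ P.popularity i →
    198 * (P.D : ℝ) ≤ √(P.popularity i / P.popularity j)

/-! ### Strategies and the optimal rate -/

/-- A user `⟨i, k, u⟩` requests a file of level `i`; it is the `u`-th among the `U i` such users
that are connected to the `d i` consecutive caches starting at cache `k`. -/
abbrev User (P : CachingSetup L) : Type := (i : Fin L) × (Fin P.K × Fin (P.U i))

/-- The caches are arranged cyclically; `accessed k j` is the cache `j` steps after cache `k`. -/
def accessed {K : ℕ} (k : Fin K) (j : ℕ) : Fin K :=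
  ⟨(k.val + j) % K, Nat.mod_lt _ k.pos⟩

/-- Contents of all the files of all levels, for files of size `F` bits. -/
abbrev Library (P : CachingSetup L) (F : ℕ) : Type :=
  (i : Fin L) → Fin (P.N i) → (Fin F → Bool)

/-- A user request vector: every user requests a file of its level. -/
abbrev Demand (P : CachingSetup L) : Type := (u : P.User) → Fin (P.N u.1)

/-- A placement-and-delivery strategy for files of `F` bits, caches of `C` bits and broadcast
messages of `B` bits. The placement does not know the demand. All the maps may depend on a common
random seed, uniform on `Fin seeds`; deterministic strategies are those with `seeds = 1`. -/
structure Strategy (P : CachingSetup L) (F C B : ℕ) where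
  seeds : ℕ
  seeds_pos : 0 < seeds
  place : Fin seeds → P.Library F → Fin P.K → (Fin C → Bool)
  send : Fin seeds → P.Demand → P.Library F → (Fin B → Bool)
  decode : Fin seeds → P.Demand → (u : P.User) → (Fin (P.d u.1) → (Fin C → Bool)) →
    (Fin B → Bool) → (Fin F → Bool)

namespace Strategy

variable {P : CachingSetup L} {F C B : ℕ}

/-- What user `u` recovers from the broadcast message and the `d i` caches that it accesses. -/
def output (s : P.Strategy F C B) (ω : Fin s.seeds) (W : P.Library F) (r : P.Demand)
    (u : P.User) : Fin F → Bool :=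
  s.decode ω r u (fun j => s.place ω W (accessed u.2.1 j)) (s.send ω r W)

open Classical in
/-- The probability, over independent uniform file contents and the seed, that at least one user
does not recover the file it requested. -/
noncomputable def errorProb (s : P.Strategy F C B) (r : P.Demand) : ℝ :=
  ((Finset.univ.filter fun p : Fin s.seeds × P.Library F =>
      ∃ u : P.User, s.output p.1 p.2 r u ≠ p.2 u.1 (r u)).card : ℝ) /
    (Fintype.card (Fin s.seeds × P.Library F) : ℝ)

end Strategy

/-- `(R, M)` is achievable: for every tolerance and all large enough file sizes `F`, there is a
strategy with caches of `M F` bits and broadcasts of `R F` bits whose error probability is within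
the tolerance for every request vector. -/
def Achievable (P : CachingSetup L) (R M : ℝ) : Prop :=
  0 ≤ R ∧ ∀ ε : ℝ, 0 < ε → ∃ F₀ : ℕ, ∀ F : ℕ, F₀ ≤ F →
    ∃ s : P.Strategy F ⌊M * F⌋₊ ⌊R * F⌋₊, ∀ r : P.Demand, s.errorProb r ≤ ε

/-- The optimal rate-memory trade-off `R*(M)`. -/
noncomputable def optimalRate (P : CachingSetup L) (M : ℝ) : ℝ :=
  sInf {R : ℝ | P.Achievable R M}

/-! ### The memory-sharing scheme -/

/-- The single-level rate `U min {N / m, K} (1 - d m / N)`, where `N / 0` is read as infinity. -/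
noncomputable def singleLevelRate (m : ℝ) (K N U d : ℕ) : ℝ :=
  (U : ℝ) * (if m = 0 then (K : ℝ) else min ((N : ℝ) / m) K) * (1 - d * m / N)

/-- `S_A = ∑_{i ∈ A} √(N_i U_i)`. -/
noncomputable def S (P : CachingSetup L) (A : Finset (Fin L)) : ℝ :=
  ∑ i ∈ A, √((P.N i : ℝ) * P.U i)

/-- `T_A = ∑_{i ∈ A} N_i / d_i`. -/
noncomputable def T (P : CachingSetup L) (A : Finset (Fin L)) : ℝ :=
  ∑ i ∈ A, (P.N i : ℝ) / P.d i

/-- `V_A = ∑_{i ∈ A} N_i / K`. -/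
noncomputable def V (P : CachingSetup L) (A : Finset (Fin L)) : ℝ :=
  ∑ i ∈ A, (P.N i : ℝ) / P.K

/-- `M̃ = (M - T_J + V_I) / S_I`. -/
noncomputable def tildeM (P : CachingSetup L) (M : ℝ) (I J : Finset (Fin L)) : ℝ :=
  (M - P.T J + P.V I) / P.S I

/-- `(H, I, J)` partitions the set of levels. -/
def IsPartition (H I J : Finset (Fin L)) : Prop :=
  Disjoint H I ∧ Disjoint H J ∧ Disjoint I J ∧ H ∪ I ∪ J = Finset.univ

/-- `M`-feasible partitions of the set of levels. The second alternative is the case `S_I = 0`,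
where `M̃` is read as `+∞`: the memory exceeds what is needed to store everything, and all levels
are in `J`. -/
def IsFeasible (P : CachingSetup L) (M : ℝ) (H I J : Finset (Fin L)) : Prop :=
  IsPartition H I J ∧
  ((I.Nonempty ∧
      (∀ h ∈ H, P.tildeM M I J < 1 / P.K * √((P.N h : ℝ) / P.U h)) ∧
      (∀ i ∈ I, 1 / P.K * √((P.N i : ℝ) / P.U i) ≤ P.tildeM M I J ∧
        P.tildeM M I J ≤ (1 / P.d i + 1 / P.K) * √((P.N i : ℝ) / P.U i)) ∧
      (∀ j ∈ J, (1 / P.d j + 1 / P.K) * √((P.N j : ℝ) / P.U j) < P.tildeM M I J)) ∨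
    (I = ∅ ∧ H = ∅ ∧ P.T J < M))

/-- The memory `α_i M` that level `i` receives: `0` on `H`, `√(N_i U_i) M̃ - N_i / K` on `I`, and
`N_j / d_j` on `J`. -/
noncomputable def allocation (P : CachingSetup L) (M : ℝ) (H I J : Finset (Fin L))
    (i : Fin L) : ℝ :=
  if i ∈ H then 0
  else if i ∈ I then √((P.N i : ℝ) * P.U i) * P.tildeM M I J - (P.N i : ℝ) / P.K
  else (P.N i : ℝ) / P.d i

/-- The rate `R^MU(M) = ∑_i R^SL(α_i M, K, N_i, U_i, d_i)` of the memory-sharing scheme. -/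
noncomputable def memorySharingRate (P : CachingSetup L) (M : ℝ)
    (H I J : Finset (Fin L)) : ℝ :=
  ∑ i, singleLevelRate (P.allocation M H I J i) P.K (P.N i) (P.U i) (P.d i)

end CachingSetup

/-! Put x_i = √(N_i/U_i) and t = M̃. Then x_i > K t on H, x_i ≤ K t on I and x_i ≤ d_i t on J, and M
= T_J + ∑_{I} μ_i with μ_i = U_i x_i (t - x_i/K). A level costs the scheme rate K U_i on H, at most
2 U_i x_i / t on I, and 0 on J.

The matching lower bound is `Achievable.bound`. Levels have windows of s_i consecutive caches and
b_i consecutive broadcasts which determine n_i files, and ∑ n_i/s_i ≤ M + βR. It is proved for any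
polymatroid (`WindowDecoding.bound`) by growing a window of caches, averaged over cyclic shifts,
conditioning on the files decoded so far and crediting their entropy. For the levels of A₁ the
window grows one cache at a time (`total_sliding_le`); each level adjoins its own broadcasts, so β
receives ∑ b_i/s_i. For the levels of A₂ blocks of caches and broadcasts are doubled
(`total_nested_le`); all levels share the broadcasts, so β receives a single term q/m, however many
levels there are. An actual strategy yields such a polymatroid after fixing a seed that serves all
demands on half of the libraries, at the price of one bit per use of the file entropies.

For the comparison, levels of J are decoded from the d_i caches of one user, so that their credit
N_i/d_i cancels T_J. On I and H the credit minus μ_i (0 on H), times a constant, dominates t² times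
the rate of the scheme. Levels of J, and those of I with x_i < 4Dt, go into A₁; the others go into
A₂. Separation of the popularities is what bounds β by 200 D t²: it makes the cost of J a geometric
sum and leaves at most one level of I in A₁.

Feasible partitions exist by water-filling: the memory used is a continuous function of the level t.
-/

/-! ### Polymatroids and the joint entropy of finitely many partitions -/

/-- Normalized, monotone and submodular set functions. -/
structure IsPolymatroid {ι : Type*} [DecidableEq ι] (h : Finset ι → ℝ) : Prop where
  empty : h ∅ = 0
  mono : ∀ {A B : Finset ι}, A ⊆ B → h A ≤ h B
  submodular : ∀ A B : Finset ι, h (A ∪ B) + h (A ∩ B) ≤ h A + h B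

namespace IsPolymatroid

variable {ι : Type*} [DecidableEq ι] {h : Finset ι → ℝ}

theorem nonneg (hh : IsPolymatroid h) (A : Finset ι) : 0 ≤ h A := by
  rw [← hh.empty]; exact hh.mono (Finset.empty_subset A)

theorem union_le (hh : IsPolymatroid h) (A B : Finset ι) : h (A ∪ B) ≤ h A + h B := by
  linarith [hh.submodular A B, hh.nonneg (A ∩ B)]

/-- Submodularity relative to any set contained in both arguments. -/
theorem submodular_of_subset (hh : IsPolymatroid h) {A B C : Finset ι} (hA : C ⊆ A) (hB : C ⊆ B) :
    h (A ∪ B) + h C ≤ h A + h B := by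
  linarith [hh.submodular A B, hh.mono (Finset.subset_inter hA hB)]

theorem union_image_le (hh : IsPolymatroid h) {κ : Type*} (A : Finset ι) (g : κ → ι) (c : ℝ)
    (T : Finset κ) (hg : ∀ j ∈ T, h {g j} ≤ c) : h (A ∪ T.image g) ≤ h A + T.card * c := by
  classical
  induction T using Finset.induction_on with
  | empty => simp
  | insert a T ha ih =>
    have h1 := ih fun j hj => hg j (Finset.mem_insert_of_mem hj)
    have h2 := hg a (Finset.mem_insert_self a T)
    have h3 := hh.union_le (A ∪ T.image g) {g a}
    have h4 : A ∪ (insert a T).image g = A ∪ T.image g ∪ {g a} := by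
      ext; simp only [Finset.image_insert, Finset.mem_union, Finset.mem_insert,
        Finset.mem_singleton]; tauto
    rw [h4, Finset.card_insert_of_notMem ha]
    push_cast
    linarith

/-- Elements determined by a set can be adjoined to it. -/
theorem union_eq_of_insert_eq (hh : IsPolymatroid h) {A B : Finset ι}
    (hB : ∀ j ∈ B, h (insert j A) = h A) : h (A ∪ B) = h A := by
  induction B using Finset.induction_on with
  | empty => simp
  | insert a B ha ih =>
    have h1 := ih fun j hj => hB j (Finset.mem_insert_of_mem hj)
    have h2 := hB a (Finset.mem_insert_self a B)
    have h3 := hh.submodular_of_subset (A := A ∪ B) (B := insert a A) (C := A)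
      Finset.subset_union_left (Finset.subset_insert a A)
    have h4 : A ∪ B ∪ insert a A = A ∪ insert a B := by
      ext; simp only [Finset.mem_union, Finset.mem_insert]; tauto
    rw [h4] at h3
    exact le_antisymm (by linarith) (hh.mono Finset.subset_union_left)

end IsPolymatroid

/-! ### Entropy of common refinements of partitions of a finite uniform space -/

namespace PartitionEntropy

variable {Ω ι : Type*} [Fintype Ω] (E : ι → Setoid Ω)

open Classical in
/-- The class of `ω` in the common refinement of the partitions indexed by `S`. -/
noncomputable def cell (S : Finset ι) (ω : Ω) : Finset Ω :=
  Finset.univ.filter fun ω' => ∀ i ∈ S, E i ω ω'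

theorem mem_cell {S : Finset ι} {ω ω' : Ω} : ω' ∈ cell E S ω ↔ ∀ i ∈ S, E i ω ω' := by
  simp [cell]

theorem self_mem_cell (S : Finset ι) (ω : Ω) : ω ∈ cell E S ω :=
  (mem_cell E).2 fun i _ => (E i).refl ω

theorem cell_eq {S : Finset ι} {ω ω' : Ω} (hm : ω' ∈ cell E S ω) : cell E S ω' = cell E S ω := by
  rw [mem_cell] at hm
  ext a
  rw [mem_cell, mem_cell]
  exact ⟨fun ha i hi => (E i).trans (hm i hi) (ha i hi),
    fun ha i hi => (E i).trans ((E i).symm (hm i hi)) (ha i hi)⟩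

theorem cell_anti {S T : Finset ι} (hST : S ⊆ T) (ω : Ω) : cell E T ω ⊆ cell E S ω := by
  intro a ha
  rw [mem_cell] at *
  exact fun i hi => ha i (hST hi)

theorem card_cell_pos (S : Finset ι) (ω : Ω) : (0 : ℝ) < (cell E S ω).card := by
  exact_mod_cast Finset.card_pos.2 ⟨ω, self_mem_cell E S ω⟩

/-- The entropy of the common refinement of the partitions indexed by `S`, for the uniform
distribution. -/
noncomputable def entropy (S : Finset ι) : ℝ :=
  (∑ ω, (Real.log (Fintype.card Ω) - Real.log (cell E S ω).card)) / Fintype.card Ω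

/-- Summing the reciprocal of the class size over a class, or over nothing, gives at most one. -/
theorem sum_inv_card_cell_le (S : Finset ι) (T : Finset Ω) (hT : ∀ a ∈ T, T ⊆ cell E S a) :
    ∑ ω ∈ T, ((cell E S ω).card : ℝ)⁻¹ ≤ 1 := by
  rcases T.eq_empty_or_nonempty with rfl | ⟨a, ha⟩
  · simp
  · have h1 : ∀ ω ∈ T, ((cell E S ω).card : ℝ)⁻¹ = ((cell E S a).card : ℝ)⁻¹ := fun ω hω => by
      rw [cell_eq E (hT a ha hω)]
    rw [Finset.sum_congr rfl h1, Finset.sum_const, nsmul_eq_mul, ← div_eq_mul_inv,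
      div_le_one (card_cell_pos E S a)]
    exact_mod_cast Finset.card_le_card (hT a ha)

/-- This carries submodularity of entropy. The numerator counts pairs (a, b) with a in the S-class
and b in the T-class of ω. For a fixed pair such ω lie in one class of S ∪ T, so their reciprocal
class sizes sum to at most 1, and they exist only if a and b share a class of S ∩ T. -/
theorem sum_card_ratio_le [DecidableEq ι] (S T : Finset ι) :
    ∑ ω, ((cell E S ω).card : ℝ) * (cell E T ω).card /
      ((cell E (S ∪ T) ω).card * (cell E (S ∩ T) ω).card) ≤ Fintype.card Ω := by
  classical
  have e1 : ∀ ω, ((cell E S ω).card : ℝ) * (cell E T ω).card /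
      ((cell E (S ∪ T) ω).card * (cell E (S ∩ T) ω).card) =
      ∑ a, ∑ b, if a ∈ cell E S ω ∧ b ∈ cell E T ω then
        ((cell E (S ∪ T) ω).card : ℝ)⁻¹ * ((cell E (S ∩ T) ω).card : ℝ)⁻¹ else 0 := by
    intro ω
    have : ∀ a b, (if a ∈ cell E S ω ∧ b ∈ cell E T ω then
        ((cell E (S ∪ T) ω).card : ℝ)⁻¹ * ((cell E (S ∩ T) ω).card : ℝ)⁻¹ else 0) =
        (if a ∈ cell E S ω then (1 : ℝ) else 0) * (if b ∈ cell E T ω then (1 : ℝ) else 0) *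
        (((cell E (S ∪ T) ω).card : ℝ)⁻¹ * ((cell E (S ∩ T) ω).card : ℝ)⁻¹) := by
      intro a b
      by_cases ha : a ∈ cell E S ω <;> by_cases hb : b ∈ cell E T ω <;> simp [ha, hb]
    simp_rw [this, ← Finset.sum_mul, ← Finset.mul_sum, ← Finset.sum_mul]
    rw [Finset.sum_boole, Finset.sum_boole, Finset.filter_mem_eq_inter, Finset.filter_mem_eq_inter,
      Finset.univ_inter, Finset.univ_inter]
    field_simp
  have e2 : ∀ a b, (∑ ω, if a ∈ cell E S ω ∧ b ∈ cell E T ω then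
        ((cell E (S ∪ T) ω).card : ℝ)⁻¹ * ((cell E (S ∩ T) ω).card : ℝ)⁻¹ else 0) ≤
      if b ∈ cell E (S ∩ T) a then ((cell E (S ∩ T) a).card : ℝ)⁻¹ else 0 := by
    intro a b
    rw [← Finset.sum_filter]
    set Q := Finset.univ.filter fun ω => a ∈ cell E S ω ∧ b ∈ cell E T ω with hQ
    have hQm : ∀ ω ∈ Q, (∀ i ∈ S, E i ω a) ∧ ∀ i ∈ T, E i ω b := by
      intro ω hω
      simpa [hQ, mem_cell] using hω
    have hQc : ∀ ω ∈ Q, (cell E (S ∩ T) ω).card = (cell E (S ∩ T) a).card := by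
      intro ω hω
      rw [cell_eq E ((mem_cell E).2 fun i hi => (hQm ω hω).1 i (Finset.mem_inter.1 hi).1)]
    rw [Finset.sum_congr rfl fun ω hω => by rw [hQc ω hω], ← Finset.sum_mul]
    have hQ1 : ∑ ω ∈ Q, ((cell E (S ∪ T) ω).card : ℝ)⁻¹ ≤ 1 := by
      apply sum_inv_card_cell_le
      intro ω hω ω' hω'
      rw [mem_cell]
      intro i hi
      rcases Finset.mem_union.1 hi with hi | hi
      · exact (E i).trans ((hQm ω hω).1 i hi) ((E i).symm ((hQm ω' hω').1 i hi))
      · exact (E i).trans ((hQm ω hω).2 i hi) ((E i).symm ((hQm ω' hω').2 i hi))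
    split_ifs with hb
    · have := (inv_pos.2 (card_cell_pos E (S ∩ T) a)).le
      nlinarith
    · have : Q = ∅ := by
        refine Finset.eq_empty_of_forall_notMem fun ω hω => hb ((mem_cell E).2 fun i hi => ?_)
        have := Finset.mem_inter.1 hi
        exact (E i).trans ((E i).symm ((hQm ω hω).1 i this.1)) ((hQm ω hω).2 i this.2)
      simp [this]
  calc _ = ∑ a, ∑ b, ∑ ω, if a ∈ cell E S ω ∧ b ∈ cell E T ω then
        ((cell E (S ∪ T) ω).card : ℝ)⁻¹ * ((cell E (S ∩ T) ω).card : ℝ)⁻¹ else 0 := by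
        rw [Finset.sum_congr rfl fun ω _ => e1 ω, Finset.sum_comm]
        exact Finset.sum_congr rfl fun a _ => Finset.sum_comm
    _ ≤ ∑ a, ∑ b, if b ∈ cell E (S ∩ T) a then ((cell E (S ∩ T) a).card : ℝ)⁻¹ else 0 :=
        Finset.sum_le_sum fun a _ => Finset.sum_le_sum fun b _ => e2 a b
    _ = ∑ a : Ω, 1 := by
        refine Finset.sum_congr rfl fun a _ => ?_
        rw [← Finset.sum_filter, Finset.filter_mem_eq_inter, Finset.univ_inter, Finset.sum_const,
          nsmul_eq_mul, mul_inv_cancel₀ (card_cell_pos E _ a).ne']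
    _ = Fintype.card Ω := by simp

theorem isPolymatroid_entropy [DecidableEq ι] [Nonempty Ω] : IsPolymatroid (entropy E) where
  empty := by simp [entropy, cell]
  mono := by
    intro A B hAB
    unfold entropy
    gcongr with ω
    · exact card_cell_pos E _ _
    · exact cell_anti E hAB ω
  submodular := by
    intro A B
    have hΩ : (0 : ℝ) < Fintype.card Ω := by exact_mod_cast Fintype.card_pos
    unfold entropy
    rw [← add_div, ← add_div, div_le_div_iff_of_pos_right hΩ, ← Finset.sum_add_distrib,
      ← Finset.sum_add_distrib, ← sub_nonpos, ← Finset.sum_sub_distrib]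
    calc _ ≤ ∑ ω, (((cell E A ω).card : ℝ) * (cell E B ω).card /
          ((cell E (A ∪ B) ω).card * (cell E (A ∩ B) ω).card) - 1) := by
          refine Finset.sum_le_sum fun ω _ => ?_
          have h1 := card_cell_pos E A ω
          have h2 := card_cell_pos E B ω
          have h3 := card_cell_pos E (A ∪ B) ω
          have h4 := card_cell_pos E (A ∩ B) ω
          have h5 := Real.log_le_sub_one_of_pos (div_pos (mul_pos h1 h2) (mul_pos h3 h4))
          rw [Real.log_div (mul_pos h1 h2).ne' (mul_pos h3 h4).ne', Real.log_mul h1.ne' h2.ne',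
            Real.log_mul h3.ne' h4.ne'] at h5
          linarith
      _ ≤ 0 := by
          rw [Finset.sum_sub_distrib]
          have := sum_card_ratio_le E A B
          simp
          linarith

theorem entropy_insert_eq [DecidableEq ι] {S : Finset ι} {j : ι}
    (hj : ∀ ω ω', (∀ i ∈ S, E i ω ω') → E j ω ω') : entropy E (insert j S) = entropy E S := by
  have : ∀ ω, cell E (insert j S) ω = cell E S ω := by
    intro ω
    ext a
    rw [mem_cell, mem_cell]
    constructor
    · exact fun h i hi => h i (Finset.mem_insert_of_mem hi)
    · intro h i hi
      rcases Finset.mem_insert.1 hi with rfl | hi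
      · exact hj _ _ h
      · exact h i hi
  simp [entropy, this]

/-- The partition into the fibres of a map has entropy at most the logarithm of the number of
values. -/
theorem entropy_singleton_le [Nonempty Ω] {α : Type*} [Fintype α] {j : ι} (g : Ω → α)
    (hg : E j = Setoid.ker g) : entropy E {j} ≤ Real.log (Fintype.card α) := by
  classical
  have hΩ : (0 : ℝ) < Fintype.card Ω := by exact_mod_cast Fintype.card_pos
  have : Nonempty α := ⟨g (Classical.arbitrary Ω)⟩
  have hα : (0 : ℝ) < Fintype.card α := by exact_mod_cast Fintype.card_pos
  have hcell : ∀ ω, cell E {j} ω = Finset.univ.filter fun ω' => g ω = g ω' := by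
    intro ω
    have hj : ∀ a, E j ω a ↔ g ω = g a := fun a => by rw [hg]; rfl
    ext a
    simp [mem_cell, hj]
  have hsum : ∑ ω, ((cell E {j} ω).card : ℝ)⁻¹ ≤ Fintype.card α := by
    rw [← Finset.sum_fiberwise (s := Finset.univ) (g := g)]
    calc _ ≤ ∑ _a : α, (1 : ℝ) := by
          refine Finset.sum_le_sum fun a _ => sum_inv_card_cell_le E {j} _ ?_
          intro ω hω ω' hω'
          rw [hcell]
          simp at *
          rw [hω, hω']
      _ = _ := by simp
  rw [entropy, div_le_iff₀ hΩ]
  -- The inequality log y ≤ y - 1 at y = |Ω| / (|cell ω| · |α|); by `hsum` the average of y is at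
  -- most 1.
  calc _ ≤ ∑ ω : Ω, ((Fintype.card Ω : ℝ) * ((cell E {j} ω).card : ℝ)⁻¹ / Fintype.card α - 1 +
        Real.log (Fintype.card α)) := by
        refine Finset.sum_le_sum fun ω _ => ?_
        have h1 := card_cell_pos E {j} ω
        have h5 := Real.log_le_sub_one_of_pos (div_pos (mul_pos hΩ (inv_pos.2 h1)) hα)
        rw [Real.log_div (mul_pos hΩ (inv_pos.2 h1)).ne' hα.ne',
          Real.log_mul hΩ.ne' (inv_pos.2 h1).ne', Real.log_inv] at h5
        linarith
    _ = (Fintype.card Ω : ℝ) * ((∑ ω, ((cell E {j} ω).card : ℝ)⁻¹) / Fintype.card α - 1) +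
        Real.log (Fintype.card α) * Fintype.card Ω := by
        rw [Finset.sum_add_distrib, Finset.sum_sub_distrib, ← Finset.sum_div, ← Finset.mul_sum]
        simp
        ring
    _ ≤ _ := by
        have : (∑ ω, ((cell E {j} ω).card : ℝ)⁻¹) / Fintype.card α - 1 ≤ 0 := by
          rw [sub_nonpos, div_le_one hα]; exact hsum
        nlinarith

/-- If all classes are small, the entropy is large. -/
theorem le_entropy [Nonempty Ω] (S : Finset ι) (c : ℝ)
    (hc : ∀ ω, Real.log (cell E S ω).card ≤ Real.log (Fintype.card Ω) - c) : c ≤ entropy E S := by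
  have hΩ : (0 : ℝ) < Fintype.card Ω := by exact_mod_cast Fintype.card_pos
  rw [entropy, le_div_iff₀ hΩ]
  calc c * Fintype.card Ω = ∑ _ω : Ω, c := by simp [mul_comm]
    _ ≤ _ := Finset.sum_le_sum fun ω _ => by linarith [hc ω]

end PartitionEntropy

/-! ### Sliding windows -/

/-- The terms `z k, …, z (k + s - 1)` of a sequence. -/
def window {ι : Type*} [DecidableEq ι] (z : ℕ → ι) (k s : ℕ) : Finset ι :=
  (Finset.range s).image fun j => z (k + j)

section Window

variable {ι : Type*} [DecidableEq ι] (z : ℕ → ι)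

theorem mem_window {k s : ℕ} {a : ι} : a ∈ window z k s ↔ ∃ j < s, z (k + j) = a := by
  simp [window]

theorem window_zero (k : ℕ) : window z k 0 = ∅ := by simp [window]

theorem window_one (k : ℕ) : window z k 1 = {z k} := by simp [window]

theorem window_add (k a b : ℕ) : window z k (a + b) = window z k a ∪ window z (k + a) b := by
  ext x
  simp only [mem_window, Finset.mem_union]
  constructor
  · rintro ⟨j, hj, rfl⟩
    rcases lt_or_ge j a with h | h
    · exact Or.inl ⟨j, h, rfl⟩
    · exact Or.inr ⟨j - a, by omega, by congr 1; omega⟩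
  · rintro (⟨j, hj, rfl⟩ | ⟨j, hj, rfl⟩)
    · exact ⟨j, by omega, rfl⟩
    · exact ⟨a + j, by omega, by congr 1; omega⟩

theorem window_mono (k : ℕ) {a b : ℕ} (hab : a ≤ b) : window z k a ⊆ window z k b := by
  obtain ⟨c, rfl⟩ := Nat.exists_eq_add_of_le hab
  rw [window_add]; exact Finset.subset_union_left

theorem window_periodic {K : ℕ} (hz : ∀ k, z (k + K) = z k) (k s : ℕ) :
    window z (k + K) s = window z k s := by
  ext x
  simp only [mem_window]
  have : ∀ j, z (k + K + j) = z (k + j) := fun j => by rw [add_right_comm, hz]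
  simp [this]

end Window

/-- Shifting a periodic function does not change its sum over a period. -/
theorem sum_range_shift_of_periodic {K : ℕ} {g : ℕ → ℝ} (hg : ∀ k, g (k + K) = g k) (c : ℕ) :
    ∑ k ∈ Finset.range K, g (k + c) = ∑ k ∈ Finset.range K, g k := by
  induction c with
  | zero => rfl
  | succ c ih =>
    rw [← ih]
    have h1 := Finset.sum_range_succ (fun k => g (k + c)) K
    have h2 := Finset.sum_range_succ' (fun k => g (k + c)) K
    have h3 : g (K + c) = g (0 + c) := by rw [add_comm K c, hg, zero_add]
    have h4 : ∀ k, g (k + (c + 1)) = g (k + 1 + c) := fun k => by congr 1; omega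
    simp_rw [h4]
    linarith

namespace IsPolymatroid

variable {ι : Type*} [DecidableEq ι] {h : Finset ι → ℝ}

/-- Sliding-window inequality: the average entropy of the windows of a cyclic sequence, divided by
the size of the windows, is nonincreasing in this size. -/
theorem sliding_window (hh : IsPolymatroid h) {z : ℕ → ι} {K : ℕ} (hz : ∀ k, z (k + K) = z k)
    (C : Finset ι) (s : ℕ) :
    (s : ℝ) * ∑ k ∈ Finset.range K, (h (window z k (s + 1) ∪ C) - h C) ≤
      (s + 1) * ∑ k ∈ Finset.range K, (h (window z k s ∪ C) - h C) := by
  induction s with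
  | zero => simp [window_zero]
  | succ s ih =>
    have hper : ∀ s k, h (window z (k + K) s ∪ C) - h C = h (window z k s ∪ C) - h C := fun s k => by
      rw [window_periodic z hz]
    -- The summed entropy is concave in the window size: two windows of size s + 1 shifted by one
    -- overlap in a window of size s. Concavity and the induction hypothesis give the claim.
    have hconc : (∑ k ∈ Finset.range K, (h (window z k (s + 1 + 1) ∪ C) - h C)) +
        ∑ k ∈ Finset.range K, (h (window z k s ∪ C) - h C) ≤
        2 * ∑ k ∈ Finset.range K, (h (window z k (s + 1) ∪ C) - h C) := by
      have e1 := sum_range_shift_of_periodic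
        (g := fun k => h (window z k s ∪ C) - h C) (hper s) 1
      have e2 := sum_range_shift_of_periodic
        (g := fun k => h (window z k (s + 1) ∪ C) - h C) (hper (s + 1)) 1
      rw [← e1, two_mul]
      nth_rw 2 [← e2]
      rw [← Finset.sum_add_distrib, ← Finset.sum_add_distrib]
      refine Finset.sum_le_sum fun k _ => ?_
      have h1 : window z k (s + 1) = window z k 1 ∪ window z (k + 1) s := by
        rw [add_comm s 1, window_add]
      have h2 : window z (k + 1) (s + 1) = window z (k + 1) s ∪ window z (k + 1 + s) 1 :=
        window_add _ _ _ _
      have h3 : window z k (s + 1 + 1) = window z k 1 ∪ window z (k + 1) (s + 1) := by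
        rw [add_comm (s + 1) 1, window_add]
      have h4 := hh.submodular_of_subset (A := window z k (s + 1) ∪ C)
        (B := window z (k + 1) (s + 1) ∪ C) (C := window z (k + 1) s ∪ C)
        (by rw [h1]; exact Finset.union_subset_union_left Finset.subset_union_right)
        (by rw [h2]; exact Finset.union_subset_union_left Finset.subset_union_left)
      have h5 : window z k (s + 1) ∪ C ∪ (window z (k + 1) (s + 1) ∪ C) =
          window z k (s + 1 + 1) ∪ C := by
        rw [h3, h1, h2]; ext; simp only [Finset.mem_union]; tauto
      rw [h5] at h4
      linarith
    push_cast at *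
    nlinarith

theorem union_biUnion_eq (hh : IsPolymatroid h) {κ : Type*} [DecidableEq κ] {w : κ → Finset ι}
    {S : Finset ι} (B : Finset κ) (hdec : ∀ i ∈ B, ∀ j ∈ w i, h (insert j S) = h S) :
    h (S ∪ B.biUnion w) = h S :=
  hh.union_eq_of_insert_eq fun j hj => by
    obtain ⟨i, hi, hj⟩ := Finset.mem_biUnion.1 hj
    exact hdec i hi j hj

end IsPolymatroid

/-- Data for the cut-set type bounds: a polymatroid `h` with a cyclic sequence `z` (caches), a
sequence `x` (broadcasts) and sets `w i` (files of level `i`) of nearly full entropy, such that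
`s i` consecutive caches and `b i` consecutive broadcasts determine `w i`. -/
structure WindowDecoding {ι κ : Type*} [DecidableEq ι] [DecidableEq κ] (h : Finset ι → ℝ) (K : ℕ)
    (z x : ℕ → ι) (w : κ → Finset ι) (s b : κ → ℕ) (g : κ → ℝ) (cM cR δ : ℝ) : Prop where
  polymatroid : IsPolymatroid h
  periodic : ∀ k, z (k + K) = z k
  cache_le : ∀ k, h {z k} ≤ cM
  broadcast_le : ∀ t, h {x t} ≤ cR
  files_ge : ∀ A B : Finset κ, Disjoint A B →
    h (A.biUnion w) + ∑ i ∈ B, g i - δ ≤ h ((A ∪ B).biUnion w)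
  decode : ∀ i k t S, window z k (s i) ∪ window x t (b i) ⊆ S → ∀ j ∈ w i, h (insert j S) = h S

/-! ### The non-cut-set inequality for polymatroids with window decoding -/

namespace WindowDecoding

variable {ι κ : Type*} [DecidableEq ι] [DecidableEq κ] {h : Finset ι → ℝ} {K : ℕ} {z x : ℕ → ι}
  {w : κ → Finset ι} {s b : κ → ℕ} {g : κ → ℝ} {cM cR δ : ℝ}

/-- The total conditional entropy, over all shifts of the caches, of `s` caches and `b` broadcasts
given the files of the levels in `A`. -/
def total (h : Finset ι → ℝ) (K : ℕ) (z x : ℕ → ι) (w : κ → Finset ι) (s t b : ℕ) (A : Finset κ) :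
    ℝ :=
  ∑ k ∈ Finset.range K, (h (window z k s ∪ window x t b ∪ A.biUnion w) - h (A.biUnion w))

theorem total_nonneg (H : WindowDecoding h K z x w s b g cM cR δ) (m t c : ℕ) (A : Finset κ) :
    0 ≤ total h K z x w m t c A :=
  Finset.sum_nonneg fun _ _ => sub_nonneg.2 (H.polymatroid.mono Finset.subset_union_right)

/-- Decoding the files of the levels in `B` reduces the conditional entropy. -/
theorem total_union_le (H : WindowDecoding h K z x w s b g cM cR δ) {m c : ℕ} (t : ℕ)
    {A B : Finset κ} (hAB : Disjoint A B) (hm : ∀ i ∈ B, s i ≤ m) (hc : ∀ i ∈ B, b i ≤ c) :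
    total h K z x w m t c (A ∪ B) ≤ total h K z x w m t c A - K * (∑ i ∈ B, g i - δ) := by
  have h1 := H.files_ge A B hAB
  have h2 : (K : ℝ) * (∑ i ∈ B, g i - δ) = ∑ _k ∈ Finset.range K, (∑ i ∈ B, g i - δ) := by
    rw [Finset.sum_const, Finset.card_range, nsmul_eq_mul]
  unfold total
  rw [h2, ← Finset.sum_sub_distrib]
  refine Finset.sum_le_sum fun k _ => ?_
  have h3 := H.polymatroid.union_biUnion_eq (w := w)
    (S := window z k m ∪ window x t c ∪ A.biUnion w) B
    fun i hi j hj => H.decode i k t _ (by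
      refine Finset.Subset.trans ?_ Finset.subset_union_left
      exact Finset.union_subset_union (window_mono z k (hm i hi)) (window_mono x t (hc i hi))) j hj
  have h4 : window z k m ∪ window x t c ∪ A.biUnion w ∪ B.biUnion w =
      window z k m ∪ window x t c ∪ (A ∪ B).biUnion w := by
    rw [Finset.union_assoc, ← Finset.union_biUnion]
  rw [h4] at h3
  linarith

theorem total_broadcast_le (H : WindowDecoding h K z x w s b g cM cR δ) (m t c : ℕ)
    (A : Finset κ) : total h K z x w m t c A ≤ total h K z x w m t 0 A + K * (c * cR) := by
  have h2 : (K : ℝ) * (c * cR) = ∑ _k ∈ Finset.range K, (c * cR) := by simp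
  unfold total
  rw [h2, ← Finset.sum_add_distrib]
  refine Finset.sum_le_sum fun k _ => ?_
  have h1 := H.polymatroid.union_image_le (window z k m ∪ A.biUnion w) (fun j => x (t + j)) cR
    (Finset.range c) fun j _ => H.broadcast_le _
  rw [Finset.card_range] at h1
  rw [window_zero, Finset.union_empty, Finset.union_right_comm]
  unfold window at *
  linarith

theorem total_le_total_broadcast (H : WindowDecoding h K z x w s b g cM cR δ) (m t c : ℕ)
    (A : Finset κ) : total h K z x w m t 0 A ≤ total h K z x w m t c A := by
  unfold total
  refine Finset.sum_le_sum fun k _ => sub_le_sub_right (H.polymatroid.mono ?_) _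
  exact Finset.union_subset_union_left (Finset.union_subset_union_right
    (window_mono x t (Nat.zero_le c)))

theorem total_succ_le (H : WindowDecoding h K z x w s b g cM cR δ) (m : ℕ) (A : Finset κ) :
    (m : ℝ) * total h K z x w (m + 1) 0 0 A ≤ (m + 1) * total h K z x w m 0 0 A := by
  have := H.polymatroid.sliding_window H.periodic (A.biUnion w) m
  simpa [total, window_zero] using this

/-- Splitting a block of caches and broadcasts into two. -/
theorem total_add_le (H : WindowDecoding h K z x w s b g cM cR δ) (m t c : ℕ) (A : Finset κ) :
    total h K z x w (m + m) t (c + c) A ≤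
      total h K z x w m t c A + total h K z x w m (t + c) c A := by
  -- The sum runs over all cyclic shifts, so the second block may start m caches later.
  have e : total h K z x w m (t + c) c A = ∑ k ∈ Finset.range K,
      (h (window z (k + m) m ∪ window x (t + c) c ∪ A.biUnion w) - h (A.biUnion w)) := by
    symm
    exact sum_range_shift_of_periodic (g := fun k =>
      h (window z k m ∪ window x (t + c) c ∪ A.biUnion w) - h (A.biUnion w))
      (fun k => by rw [window_periodic z H.periodic]) m
  rw [e]
  unfold total
  rw [← Finset.sum_add_distrib]
  refine Finset.sum_le_sum fun k _ => ?_
  have h1 := H.polymatroid.submodular_of_subset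
    (A := window z k m ∪ window x t c ∪ A.biUnion w)
    (B := window z (k + m) m ∪ window x (t + c) c ∪ A.biUnion w) (C := A.biUnion w)
    Finset.subset_union_right Finset.subset_union_right
  have h2 : window z k m ∪ window x t c ∪ A.biUnion w ∪
      (window z (k + m) m ∪ window x (t + c) c ∪ A.biUnion w) =
      window z k (m + m) ∪ window x t (c + c) ∪ A.biUnion w := by
    rw [window_add, window_add]; ext; simp only [Finset.mem_union]; tauto
  rw [h2] at h1
  linarith

/-- Levels decoded from few caches: after decoding, the conditional entropy of the windows is
small. -/
theorem total_sliding_le (H : WindowDecoding h K z x w s b g cM cR δ) (hδ : 0 ≤ δ) (A : Finset κ)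
    (hs : ∀ i ∈ A, 1 ≤ s i) (m : ℕ) :
    total h K z x w (m + 1) 0 0 (A.filter fun i => s i < m + 1) ≤
      (m + 1) * (K * (cM + ∑ i ∈ A.filter (fun i => s i < m + 1), (b i * cR - g i) / s i +
        m * δ)) := by
  induction m with
  | zero =>
    have h1 : A.filter (fun i => s i < 0 + 1) = ∅ :=
      Finset.filter_eq_empty_iff.2 fun i hi => by have := hs i hi; omega
    rw [h1]
    simp only [total, zero_add, window_one, window_zero, Finset.biUnion_empty, Finset.union_empty,
      H.polymatroid.empty, sub_zero, Finset.sum_empty]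
    calc _ ≤ ∑ _k ∈ Finset.range K, cM := Finset.sum_le_sum fun k _ => H.cache_le k
      _ = _ := by simp
  | succ m ih =>
    set A₀ := A.filter fun i => s i < m + 1 with hA₀
    set B := A.filter fun i => s i = m + 1 with hB
    have hdisj : Disjoint A₀ B := by
      rw [Finset.disjoint_filter]; intro i _ h1 h2; omega
    have hU : A.filter (fun i => s i < m + 1 + 1) = A₀ ∪ B := by
      rw [hA₀, hB, ← Finset.filter_or]
      exact Finset.filter_congr fun i _ => by omega
    rw [hU, Finset.sum_union hdisj]
    have hBs : ∀ i ∈ B, s i = m + 1 := fun i hi => (Finset.mem_filter.1 hi).2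
    -- Broadcasts are adjoined (`h2`) only to decode B, then discarded (`h3`) before the window
    -- slides to the next size (`h4`). Dividing by the size m + 1 gives each level its term (b cR -
    -- g)/s.
    have h1 := H.total_union_le (m := m + 1) (c := ∑ i ∈ B, b i) 0 hdisj
      (fun i hi => (hBs i hi).le)
      (fun i hi => Finset.single_le_sum (f := b) (fun _ _ => Nat.zero_le _) hi)
    have h2 := H.total_broadcast_le (m + 1) 0 (∑ i ∈ B, b i) A₀
    have h3 := H.total_le_total_broadcast (m + 1) 0 (∑ i ∈ B, b i) (A₀ ∪ B)
    have h4 := H.total_succ_le (m + 1) (A₀ ∪ B)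
    have h5 : ∑ i ∈ B, (b i * cR - g i) / s i =
        (((∑ i ∈ B, b i : ℕ) : ℝ) * cR - ∑ i ∈ B, g i) / (m + 1) := by
      rw [Nat.cast_sum, Finset.sum_mul, ← Finset.sum_sub_distrib, Finset.sum_div]
      refine Finset.sum_congr rfl fun i hi => ?_
      rw [hBs i hi]; push_cast; rfl
    rw [h5]
    have hm : (0 : ℝ) < (m : ℝ) + 1 := by positivity
    have hK : (0 : ℝ) ≤ K := Nat.cast_nonneg K
    push_cast at *
    set X := ∑ i ∈ A₀, (b i * cR - g i) / s i
    set q := (∑ i ∈ B, (b i : ℝ)) * cR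
    set p := ∑ i ∈ B, g i
    have h6 : total h K z x w (m + 1) 0 0 (A₀ ∪ B) ≤
        (m + 1) * (K * (cM + X + m * δ)) + K * q - K * (p - δ) := by linarith
    have h7 : ((m : ℝ) + 1) * total h K z x w (m + 1 + 1) 0 0 (A₀ ∪ B) ≤
        (m + 1) * ((m + 1 + 1) * (K * (cM + X + m * δ)) +
        (m + 1 + 1) * ((K * q - K * (p - δ)) / (m + 1))) := by
      calc _ ≤ (m + 1 + 1) * ((m + 1) * (K * (cM + X + m * δ)) + K * q - K * (p - δ)) := by
            refine h4.trans (mul_le_mul_of_nonneg_left h6 (by positivity))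
        _ = _ := by field_simp; ring
    have h8 := le_of_mul_le_mul_left h7 hm
    refine h8.trans ?_
    rw [← mul_add]
    refine mul_le_mul_of_nonneg_left ?_ (by positivity)
    have h9 : δ / (m + 1) ≤ δ := div_le_self hδ (by linarith)
    have h10 : K * (δ / (m + 1)) ≤ K * δ := mul_le_mul_of_nonneg_left h9 hK
    have h11 : (K * q - K * (p - δ)) / ((m : ℝ) + 1) = K * ((q - p) / (m + 1)) +
      K * (δ / (m + 1)) := by field_simp; ring
    rw [h11]
    linarith

/-- Levels decoded from nested blocks of `m 2 ^ e` caches and `c 2 ^ e` broadcasts. -/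
theorem total_nested_le (H : WindowDecoding h K z x w s b g cM cR δ) (hδ : 0 ≤ δ) {A₁ A₂ : Finset κ}
    (hA : Disjoint A₁ A₂) {m c : ℕ} (e : κ → ℕ) (hs : ∀ i ∈ A₂, s i = m * 2 ^ e i)
    (hb : ∀ i ∈ A₂, b i = c * 2 ^ e i) (n : ℕ) (t : ℕ) :
    total h K z x w (m * 2 ^ n) t (c * 2 ^ n) (A₁ ∪ A₂.filter fun i => e i < n) ≤
      2 ^ n * (total h K z x w m 0 0 A₁ + K * (c * cR) -
        K * ∑ i ∈ A₂.filter (fun i => e i < n), g i / 2 ^ e i + K * (n * δ)) := by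
  induction n generalizing t with
  | zero =>
    have := H.total_broadcast_le m t c A₁
    have hw : total h K z x w m t 0 A₁ = total h K z x w m 0 0 A₁ := by simp only [total, window_zero]
    rw [hw] at this
    simp
    linarith
  | succ n ih =>
    set A₀ := A₂.filter fun i => e i < n with hA₀
    set B := A₂.filter fun i => e i = n with hB
    have hdisj : Disjoint A₀ B := by
      rw [Finset.disjoint_filter]; intro i _ h1 h2; omega
    have hdisj' : Disjoint (A₁ ∪ A₀) B := by
      rw [Finset.disjoint_union_left]
      exact ⟨hA.mono_right (Finset.filter_subset _ _), hdisj⟩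
    have hU : A₂.filter (fun i => e i < n + 1) = A₀ ∪ B := by
      rw [hA₀, hB, ← Finset.filter_or]
      exact Finset.filter_congr fun i _ => by omega
    have hBe : ∀ i ∈ B, i ∈ A₂ ∧ e i = n := fun i hi => Finset.mem_filter.1 hi
    rw [hU, Finset.sum_union hdisj, ← Finset.union_assoc]
    -- Needed for every t because the two halves of the doubled block carry different broadcasts;
    -- both determine the same files of B, which are therefore credited twice.
    have h1 : ∀ t, total h K z x w (m * 2 ^ n) t (c * 2 ^ n) (A₁ ∪ A₀ ∪ B) ≤
        total h K z x w (m * 2 ^ n) t (c * 2 ^ n) (A₁ ∪ A₀) - K * (∑ i ∈ B, g i - δ) := fun t =>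
      H.total_union_le t hdisj' (fun i hi => by rw [hs i (hBe i hi).1, (hBe i hi).2])
        (fun i hi => by rw [hb i (hBe i hi).1, (hBe i hi).2])
    have h2 := H.total_add_le (m * 2 ^ n) t (c * 2 ^ n) (A₁ ∪ A₀ ∪ B)
    have h3 : ∀ y : ℕ, y * 2 ^ (n + 1) = y * 2 ^ n + y * 2 ^ n := fun y => by ring
    have h5 : ∑ i ∈ B, g i / 2 ^ e i = (∑ i ∈ B, g i) / 2 ^ n := by
      rw [Finset.sum_div]
      exact Finset.sum_congr rfl fun i hi => by rw [(hBe i hi).2]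
    rw [h3, h3, h5]
    have h6 := h1 t
    have h7 := h1 (t + c * 2 ^ n)
    have h8 := ih t
    have h9 := ih (t + c * 2 ^ n)
    set p := ∑ i ∈ B, g i
    set X := ∑ i ∈ A₀, g i / 2 ^ e i
    set Ψ := total h K z x w m 0 0 A₁ + K * (c * cR)
    have h10 : (2 : ℝ) ^ (n + 1) * (Ψ - K * (X + p / 2 ^ n) + K * ((n + 1 : ℕ) * δ)) =
        2 * (2 ^ n * (Ψ - K * X + K * (n * δ))) - 2 * (K * p) + 2 * (2 ^ n * (K * δ)) := by
      push_cast
      field_simp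
      ring
    rw [h10]
    have h11 : (K : ℝ) * δ ≤ 2 ^ n * (K * δ) :=
      le_mul_of_one_le_left (by positivity) (one_le_pow₀ (by norm_num))
    linarith

/-- The resulting non-cut-set bound. -/
theorem bound (H : WindowDecoding h K z x w s b g cM cR δ) (hK : 0 < K) (hδ : 0 ≤ δ)
    {A₁ A₂ : Finset κ} (hA : Disjoint A₁ A₂) {m c : ℕ} (hm : 0 < m) (e : κ → ℕ)
    (hs₁ : ∀ i ∈ A₁, 1 ≤ s i ∧ s i < m) (hs : ∀ i ∈ A₂, s i = m * 2 ^ e i)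
    (hb : ∀ i ∈ A₂, b i = c * 2 ^ e i) :
    ∑ i ∈ A₁, g i / s i + ∑ i ∈ A₂, g i / s i ≤
      cM + (∑ i ∈ A₁, (b i : ℝ) / s i + c / m) * cR + (m + ∑ i ∈ A₂, e i + 1 : ℕ) * δ := by
  obtain ⟨m, rfl⟩ : ∃ m', m = m' + 1 := ⟨m - 1, by omega⟩
  have h1 := H.total_sliding_le hδ A₁ (fun i hi => (hs₁ i hi).1) m
  rw [Finset.filter_true_of_mem fun i hi => (hs₁ i hi).2] at h1
  -- This n exceeds every exponent, so n doublings decode all of A₂. Nonnegativity of the remaining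
  -- conditional entropy is then the bound.
  set n := ∑ i ∈ A₂, e i + 1 with hn
  have h2 := H.total_nested_le hδ hA e hs hb n 0
  rw [Finset.filter_true_of_mem fun i hi => by
    have := Finset.single_le_sum (f := e) (fun _ _ => Nat.zero_le _) hi; omega] at h2
  have h3 := (H.total_nonneg ((m + 1) * 2 ^ n) 0 (c * 2 ^ n) (A₁ ∪ A₂)).trans h2
  have h4 := nonneg_of_mul_nonneg_right h3 (by positivity)
  have hK' : (0 : ℝ) < K := by exact_mod_cast hK
  have hm' : (0 : ℝ) < (m : ℝ) + 1 := by positivity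
  set X₂ := ∑ i ∈ A₂, g i / 2 ^ e i with hX₂
  have e2 : ∑ i ∈ A₂, g i / s i = X₂ / (m + 1) := by
    rw [hX₂, Finset.sum_div]
    refine Finset.sum_congr rfl fun i hi => ?_
    rw [hs i hi]; push_cast; field_simp
  have e1 : ∑ i ∈ A₁, (b i * cR - g i) / s i =
      (∑ i ∈ A₁, (b i : ℝ) / s i) * cR - ∑ i ∈ A₁, g i / s i := by
    rw [Finset.sum_mul, ← Finset.sum_sub_distrib]
    exact Finset.sum_congr rfl fun i _ => by ring
  rw [e1] at h1
  rw [e2]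
  set G₁ := ∑ i ∈ A₁, g i / s i
  set B₁ := ∑ i ∈ A₁, (b i : ℝ) / s i
  have h5 : 0 ≤ K * ((m + 1) * (cM + (B₁ * cR - G₁) + m * δ) + c * cR - X₂ + n * δ) := by
    linarith
  have h6 := nonneg_of_mul_nonneg_right h5 hK'
  have h7 : ((m + 1 : ℕ) + ∑ i ∈ A₂, e i + 1 : ℕ) = m + 1 + n := by omega
  have h8 : X₂ / ((m : ℝ) + 1) ≤
      (cM + (B₁ * cR - G₁) + m * δ) + c / (m + 1) * cR + n * δ / (m + 1) := by
    rw [div_le_iff₀ hm']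
    have : (cM + (B₁ * cR - G₁) + m * δ + c / (m + 1) * cR + n * δ / (m + 1)) * ((m : ℝ) + 1) =
      (m + 1) * (cM + (B₁ * cR - G₁) + m * δ) + c * cR + n * δ := by field_simp
    linarith
  have h9 : (n : ℝ) * δ / (m + 1) ≤ n * δ := div_le_self (by positivity) (by linarith)
  rw [h7]
  push_cast
  nlinarith

end WindowDecoding

/-! ### Converse bounds for achievable rates -/

theorem exists_add_mod_eq {b a : ℕ} (ha : a < b) (t : ℕ) : ∃ j < b, (t + j) % b = a := by
  have hb : 0 < b := by omega
  refine ⟨(a + (b - t % b)) % b, Nat.mod_lt _ hb, ?_⟩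
  have h1 := Nat.mod_lt t hb
  have h2 := Nat.mod_add_div t b
  rw [Nat.add_mod_mod]
  have : t + (a + (b - t % b)) = a + b * (t / b + 1) := by
    rw [mul_add, mul_one]; omega
  rw [this, Nat.add_mul_mod_self_left, Nat.mod_eq_of_lt ha]

/-- Among `2 c - 1` cyclically consecutive positions in `0, …, K - 1`, all residues modulo `c`
occur. -/
theorem exists_add_mod_mod_eq {K c a : ℕ} (hc : c ≤ K) (ha : a < c) (k : ℕ) :
    ∃ p, p + 2 ≤ 2 * c ∧ (k + p) % K % c = a := by
  have hK : 0 < K := by omega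
  have hk := Nat.mod_lt k hK
  by_cases h : k % K + c ≤ K
  · obtain ⟨j, hj, hja⟩ := exists_add_mod_eq ha (k % K)
    refine ⟨j, by omega, ?_⟩
    rw [← Nat.mod_add_mod, Nat.mod_eq_of_lt (by omega : k % K + j < K), hja]
  -- The next c positions would wrap around. Fewer than c steps lead to position 0 of the next turn,
  -- from which residue a is a steps away.
  · refine ⟨K - k % K + a, by omega, ?_⟩
    rw [← Nat.mod_add_mod, (by omega : k % K + (K - k % K + a) = a + K), Nat.add_mod_right,
      Nat.mod_eq_of_lt (by omega : a < K), Nat.mod_eq_of_lt ha]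

/-! ### From a strategy to a window-decoding polymatroid -/

namespace CachingSetup

variable {L : ℕ}

/-- A union bound over the finitely many demands leaves at most half of the pairs (seed, library)
bad, so some seed is good for at least half of the libraries. On those decoding is exact, which
makes decoded files have conditional entropy exactly 0. -/
theorem Strategy.exists_good_seed {P : CachingSetup L} {F C B : ℕ} (s : P.Strategy F C B)
    (hD : 0 < Fintype.card P.Demand)
    (hs : ∀ r, s.errorProb r ≤ 1 / (2 * Fintype.card P.Demand)) :
    ∃ (ω : Fin s.seeds) (G : Finset (P.Library F)), Fintype.card (P.Library F) ≤ 2 * G.card ∧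
      ∀ W ∈ G, ∀ r u, s.output ω W r u = W u.1 (r u) := by
  classical
  by_contra! hcon
  set bad : P.Demand → Finset (Fin s.seeds × P.Library F) := fun r =>
    Finset.univ.filter fun p => ∃ u : P.User, s.output p.1 p.2 r u ≠ p.2 u.1 (r u) with hbad
  have hseeds : (0 : ℝ) < s.seeds := by exact_mod_cast s.seeds_pos
  have hlib : (0 : ℝ) < Fintype.card (P.Library F) := by exact_mod_cast Fintype.card_pos
  have hD' : (0 : ℝ) < Fintype.card P.Demand := by exact_mod_cast hD
  have h1 : ∀ r, ((bad r).card : ℝ) ≤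
      s.seeds * Fintype.card (P.Library F) / (2 * Fintype.card P.Demand) := by
    intro r
    have := hs r
    rw [Strategy.errorProb, Fintype.card_prod, Fintype.card_fin] at this
    push_cast at this
    rw [div_le_iff₀ (mul_pos hseeds hlib)] at this
    calc ((bad r).card : ℝ) ≤ _ := by convert this
      _ = _ := by ring
  have h2 : ((Finset.univ.biUnion bad).card : ℝ) ≤ s.seeds * Fintype.card (P.Library F) / 2 := by
    calc ((Finset.univ.biUnion bad).card : ℝ) ≤ ∑ r, ((bad r).card : ℝ) := by
          exact_mod_cast Finset.card_biUnion_le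
      _ ≤ ∑ _r : P.Demand, (s.seeds * Fintype.card (P.Library F) / (2 * Fintype.card P.Demand) :
          ℝ) := Finset.sum_le_sum fun r _ => h1 r
      _ = _ := by
          rw [Finset.sum_const, Finset.card_univ, nsmul_eq_mul]; field_simp
  set good : Fin s.seeds → Finset (P.Library F) := fun ω =>
    Finset.univ.filter fun W => ∀ r u, s.output ω W r u = W u.1 (r u) with hgood
  have h3 : ∀ ω, 2 * ((good ω).card : ℝ) < Fintype.card (P.Library F) := by
    intro ω
    by_contra! hle
    obtain ⟨W, hW, r, u, hne⟩ := hcon ω (good ω) (by exact_mod_cast hle)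
    exact hne ((Finset.mem_filter.1 hW).2 r u)
  have h4 : (Finset.univ : Finset (Fin s.seeds × P.Library F)) ⊆ Finset.univ.biUnion bad ∪
      (Finset.univ.sigma good).image fun p => (p.1, p.2) := by
    rintro ⟨ω, W⟩ -
    by_cases hW : W ∈ good ω
    · exact Finset.mem_union_right _ (Finset.mem_image.2 ⟨⟨ω, W⟩, by simp [hW], rfl⟩)
    · have : ∃ r u, s.output ω W r u ≠ W u.1 (r u) := by
        simpa [hgood] using hW
      obtain ⟨r, u, hu⟩ := this
      refine Finset.mem_union_left _ (Finset.mem_biUnion.2 ⟨r, Finset.mem_univ r, ?_⟩)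
      simp only [hbad, Finset.mem_filter, Finset.mem_univ, true_and]
      exact ⟨u, hu⟩
  have h5 : (s.seeds : ℝ) * Fintype.card (P.Library F) ≤ (Finset.univ.biUnion bad).card +
      ∑ ω, ((good ω).card : ℝ) := by
    have h6 := (Finset.card_le_card h4).trans (Finset.card_union_le _ _)
    have h7 : ((Finset.univ.sigma good).image fun p => (p.1, p.2)).card ≤ ∑ ω, (good ω).card := by
      rw [← Finset.card_sigma]; exact Finset.card_image_le
    rw [Finset.card_univ, Fintype.card_prod, Fintype.card_fin] at h6
    exact_mod_cast h6.trans (Nat.add_le_add_left h7 _)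
  have h8 : ∑ ω, ((good ω).card : ℝ) < s.seeds * Fintype.card (P.Library F) / 2 := by
    calc ∑ ω, ((good ω).card : ℝ) < ∑ _ω : Fin s.seeds, (Fintype.card (P.Library F) / 2 : ℝ) := by
          refine Finset.sum_lt_sum_of_nonempty ⟨⟨0, s.seeds_pos⟩, Finset.mem_univ _⟩ fun ω _ => ?_
          linarith [h3 ω]
      _ = _ := by rw [Finset.sum_const, Finset.card_univ, Fintype.card_fin, nsmul_eq_mul]; ring
  linarith

/-- The requests, caches and files, as indices of random variables. -/
abbrev Variables (P : CachingSetup L) : Type :=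
  P.Demand ⊕ Fin P.K ⊕ ((i : Fin L) × Fin (P.N i))

/-- The partitions of a set of libraries according to the broadcasts, caches and files. -/
def Strategy.partitions {P : CachingSetup L} {F C B : ℕ} (s : P.Strategy F C B)
    (ω : Fin s.seeds) (G : Finset (P.Library F)) : P.Variables → Setoid G
  | .inl r => Setoid.ker fun W => s.send ω r W
  | .inr (.inl k) => Setoid.ker fun W => s.place ω W k
  | .inr (.inr f) => Setoid.ker fun W => W.1 f.1 f.2

section Entropy

variable {P : CachingSetup L} {F C B : ℕ} (s : P.Strategy F C B) (ω : Fin s.seeds)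
  (G : Finset (P.Library F))

theorem log_card_bits (n : ℕ) : Real.log (Fintype.card (Fin n → Bool)) = n * Real.log 2 := by
  simp

theorem entropy_send_le [Nonempty G] (r : P.Demand) :
    PartitionEntropy.entropy (s.partitions ω G) {.inl r} ≤ B * Real.log 2 := by
  rw [← log_card_bits]
  exact PartitionEntropy.entropy_singleton_le _ (fun W : G => s.send ω r W) rfl

theorem entropy_place_le [Nonempty G] (k : Fin P.K) :
    PartitionEntropy.entropy (s.partitions ω G) {.inr (.inl k)} ≤ C * Real.log 2 := by
  rw [← log_card_bits]
  exact PartitionEntropy.entropy_singleton_le _ (fun W : G => s.place ω W k) rfl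

/-- The variables that correspond to the files in `T`. -/
def fileVariables (P : CachingSetup L) (T : Finset ((i : Fin L) × Fin (P.N i))) :
    Finset P.Variables :=
  T.map ⟨fun f => .inr (.inr f), fun _ _ h => Sum.inr_injective (Sum.inr_injective h)⟩

theorem entropy_files_le [Nonempty G] (T : Finset ((i : Fin L) × Fin (P.N i))) :
    PartitionEntropy.entropy (s.partitions ω G) (P.fileVariables T) ≤
      T.card * (F * Real.log 2) := by
  have h1 := (PartitionEntropy.isPolymatroid_entropy (s.partitions ω G)).union_image_le ∅
    (fun f => .inr (.inr f)) (F * Real.log 2) T fun f _ => by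
      rw [← log_card_bits]
      exact PartitionEntropy.entropy_singleton_le _ (fun W : G => W.1 f.1 f.2) rfl
  rw [(PartitionEntropy.isPolymatroid_entropy (s.partitions ω G)).empty, zero_add,
    Finset.empty_union] at h1
  rwa [fileVariables, Finset.map_eq_image]

/-- All members of the class agree on the files of T. Overwriting these by arbitrary contents is
thus an injection into the set of libraries. -/
theorem card_cell_mul_le (T : Finset ((i : Fin L) × Fin (P.N i))) (W : G) :
    (PartitionEntropy.cell (s.partitions ω G) (P.fileVariables T) W).card * (2 ^ F) ^ T.card ≤
      Fintype.card (P.Library F) := by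
  classical
  set Q := PartitionEntropy.cell (s.partitions ω G) (P.fileVariables T) W with hQ
  have hagree : ∀ V ∈ Q, ∀ f ∈ T, W.1 f.1 f.2 = V.1 f.1 f.2 := by
    intro V hV f hf
    rw [hQ, PartitionEntropy.mem_cell] at hV
    exact hV (.inr (.inr f)) (Finset.mem_map.2 ⟨f, hf, rfl⟩)
  let φ : Q × (T → Fin F → Bool) → P.Library F := fun p i n =>
    if h : (⟨i, n⟩ : (i : Fin L) × Fin (P.N i)) ∈ T then p.2 ⟨⟨i, n⟩, h⟩ else p.1.1.1 i n
  have hφ : Function.Injective φ := by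
    rintro ⟨⟨V, hV⟩, v⟩ ⟨⟨V', hV'⟩, v'⟩ heq
    have hpt : ∀ f : (i : Fin L) × Fin (P.N i),
        φ ⟨⟨V, hV⟩, v⟩ f.1 f.2 = φ ⟨⟨V', hV'⟩, v'⟩ f.1 f.2 := fun f => by rw [heq]
    have hv : v = v' := by
      funext ⟨f, hf⟩
      have := hpt f
      simpa [φ, hf] using this
    have hVV : V = V' := by
      apply Subtype.ext
      funext i n
      by_cases hf : (⟨i, n⟩ : (i : Fin L) × Fin (P.N i)) ∈ T
      · exact (hagree V hV _ hf).symm.trans (hagree V' hV' _ hf)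
      · have := hpt ⟨i, n⟩
        simpa [φ, hf] using this
    subst hv hVV
    rfl
  have := Fintype.card_le_of_injective φ hφ
  simpa using this

/-- Restricting the uniform library to a set containing at least half of all libraries costs at most
one bit, log 2. -/
theorem le_entropy_files [Nonempty G] (hG : Fintype.card (P.Library F) ≤ 2 * G.card)
    (T : Finset ((i : Fin L) × Fin (P.N i))) :
    T.card * (F * Real.log 2) - Real.log 2 ≤
      PartitionEntropy.entropy (s.partitions ω G) (P.fileVariables T) := by
  refine PartitionEntropy.le_entropy _ _ _ fun W => ?_
  have h1 := PartitionEntropy.card_cell_pos (s.partitions ω G) (P.fileVariables T) W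
  have h2 : ((PartitionEntropy.cell (s.partitions ω G) (P.fileVariables T) W).card : ℝ) *
      (2 ^ F) ^ T.card ≤ 2 * G.card := by
    exact_mod_cast (card_cell_mul_le s ω G T W).trans hG
  have hGpos : (0 : ℝ) < G.card := by
    have : 0 < G.card := Finset.card_pos.2 (Finset.nonempty_coe_sort.1 inferInstance)
    exact_mod_cast this
  have h3 := Real.log_le_log (by positivity) h2
  rw [Real.log_mul h1.ne' (by positivity), Real.log_mul (by norm_num) hGpos.ne', Real.log_pow,
    Real.log_pow] at h3
  rw [Fintype.card_coe]
  linarith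

end Entropy

/-- A sequence of requests such that, in `b i` consecutive ones, the users of level `i` in enough
consecutive caches ask for all of the first `b i * c i * U i` files. -/
def sweepingDemand (P : CachingSetup L) (hN : ∀ i, 0 < P.N i) (c b : Fin L → ℕ) (t : ℕ) :
    P.Demand := fun u =>
  if h : ((t % b u.1) * c u.1 + u.2.1 % c u.1) * P.U u.1 + u.2.2 < P.N u.1 then ⟨_, h⟩
  else ⟨0, hN u.1⟩

/-- The file number is written in mixed radix: user index in base U, cache position in base c, then
the round. Both b consecutive rounds and 2c - 1 consecutive cache positions meet every value of
their digit. -/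
theorem exists_sweepingDemand_eq (P : CachingSetup L) (hN : ∀ i, 0 < P.N i) (c b : Fin L → ℕ)
    {i : Fin L} (hc : c i ≤ P.K) (f : Fin (P.N i)) (hf : f < b i * c i * P.U i) (k t : ℕ) :
    ∃ (p j : ℕ) (h : (k + p) % P.K < P.K) (u : Fin (P.U i)), p + 2 ≤ 2 * c i ∧ j < b i ∧
      P.sweepingDemand hN c b (t + j) ⟨i, ⟨(k + p) % P.K, h⟩, u⟩ = f := by
  have hU : 0 < P.U i := Nat.pos_of_ne_zero fun h => by simp [h] at hf
  have hc0 : 0 < c i := Nat.pos_of_ne_zero fun h => by simp [h] at hf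
  have hq : f / P.U i / c i < b i := by
    rw [Nat.div_div_eq_div_mul, Nat.div_lt_iff_lt_mul (by positivity)]
    calc (f : ℕ) < _ := hf
      _ = _ := by ring
  obtain ⟨j, hj, hj'⟩ := exists_add_mod_eq hq t
  obtain ⟨p, hp, hp'⟩ := exists_add_mod_mod_eq hc (Nat.mod_lt (f / P.U i) hc0) k
  refine ⟨p, j, Nat.mod_lt _ (by omega), ⟨f % P.U i, Nat.mod_lt _ hU⟩, hp, hj, ?_⟩
  have hval : ((t + j) % b i * c i + (k + p) % P.K % c i) * P.U i + f % P.U i = f := by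
    rw [hj', hp']
    have h1 := Nat.div_add_mod (f / P.U i) (c i)
    have h2 := Nat.div_add_mod (f : ℕ) (P.U i)
    rw [mul_comm (f / P.U i / c i), h1, mul_comm, h2]
  have hlt := hval.trans_lt f.2
  simp only [sweepingDemand]
  rw [dif_pos hlt]
  exact Fin.ext hval

/-- The entropies of a good strategy satisfy the hypotheses of the window-decoding bound. -/
theorem windowDecoding (P : CachingSetup L) (hK : 0 < P.K) (hN : ∀ i, 0 < P.N i) {F C B : ℕ}
    (st : P.Strategy F C B) (ω : Fin st.seeds) (G : Finset (P.Library F)) [Nonempty G]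
    (hG : Fintype.card (P.Library F) ≤ 2 * G.card)
    (hdec : ∀ W ∈ G, ∀ r u, st.output ω W r u = W u.1 (r u)) (s c b n : Fin L → ℕ)
    (hc : ∀ i, c i ≤ P.K) (hs : ∀ i, 2 * c i + P.d i ≤ s i + 2)
    (hnN : ∀ i, n i ≤ P.N i) (hn : ∀ i, n i ≤ b i * c i * P.U i) :
    WindowDecoding (PartitionEntropy.entropy (st.partitions ω G)) P.K
      (fun k => .inr (.inl ⟨k % P.K, Nat.mod_lt _ hK⟩))
      (fun t => .inl (P.sweepingDemand hN c b t))
      (fun i => P.fileVariables ((Finset.univ.filter fun f : Fin (P.N i) => f < n i).map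
        (Function.Embedding.sigmaMk i))) s b
      (fun i => n i * (F * Real.log 2)) (C * Real.log 2) (B * Real.log 2) (Real.log 2) where
  polymatroid := PartitionEntropy.isPolymatroid_entropy _
  periodic := fun k => by simp
  cache_le := fun k => entropy_place_le st ω G _
  broadcast_le := fun t => entropy_send_le st ω G _
  files_ge := by
    intro A A' hAA'
    have key : ∀ A : Finset (Fin L), (A.biUnion fun i => P.fileVariables
        ((Finset.univ.filter fun f : Fin (P.N i) => f < n i).map
          (Function.Embedding.sigmaMk i))) =
        P.fileVariables (A.sigma fun i => Finset.univ.filter fun f : Fin (P.N i) => f < n i) := by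
      intro A
      ext v
      simp only [fileVariables, Finset.mem_biUnion, Finset.mem_map, Finset.mem_sigma]
      constructor
      · rintro ⟨i, hi, f, ⟨f', hf', rfl⟩, rfl⟩
        exact ⟨⟨i, f'⟩, ⟨hi, hf'⟩, rfl⟩
      · rintro ⟨⟨i, f'⟩, ⟨hi, hf'⟩, rfl⟩
        exact ⟨i, hi, ⟨i, f'⟩, ⟨f', hf', rfl⟩, rfl⟩
    have hcard : ∀ A : Finset (Fin L), ((A.sigma fun i =>
        Finset.univ.filter fun f : Fin (P.N i) => (f : ℕ) < n i).card : ℝ) = ∑ i ∈ A, (n i : ℝ) := by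
      intro A
      rw [Finset.card_sigma]
      push_cast
      refine Finset.sum_congr rfl fun i _ => ?_
      rw [Fin.card_filter_val_lt, min_eq_right (hnN i)]
    rw [key, key]
    have h1 := entropy_files_le st ω G
      (A.sigma fun i => Finset.univ.filter fun f : Fin (P.N i) => f < n i)
    have h2 := le_entropy_files st ω G hG
      ((A ∪ A').sigma fun i => Finset.univ.filter fun f : Fin (P.N i) => f < n i)
    rw [hcard] at h1 h2
    rw [Finset.sum_union hAA'] at h2
    rw [← Finset.sum_mul]
    linarith
  decode := by
    intro i k t S hS j hj
    simp only [fileVariables, Finset.mem_map] at hj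
    obtain ⟨_, ⟨f, hf, rfl⟩, rfl⟩ := hj
    have hf' : (f : ℕ) < n i := (Finset.mem_filter.1 hf).2
    obtain ⟨p, j, hlt, u, hp, hj, hreq⟩ := P.exists_sweepingDemand_eq hN c b (hc i) f
      (hf'.trans_le (hn i)) k t
    have hS' := Finset.union_subset_iff.1 hS
    apply PartitionEntropy.entropy_insert_eq
    intro W V hWV
    change W.1 i f = V.1 i f
    have hout := fun W : G => hdec W.1 W.2 (P.sweepingDemand hN c b (t + j))
      ⟨i, ⟨(k + p) % P.K, hlt⟩, u⟩
    simp only [hreq] at hout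
    rw [← hout W, ← hout V]
    have hsend : st.send ω (P.sweepingDemand hN c b (t + j)) W.1 =
        st.send ω (P.sweepingDemand hN c b (t + j)) V.1 :=
      hWV (.inl (P.sweepingDemand hN c b (t + j)))
        (hS'.2 ((mem_window _).2 ⟨j, hj, rfl⟩))
    have hplace : ∀ l : Fin (P.d i), st.place ω W.1 (accessed ⟨(k + p) % P.K, hlt⟩ l) =
        st.place ω V.1 (accessed ⟨(k + p) % P.K, hlt⟩ l) := by
      intro l
      -- Here p ≤ 2c - 2 and l ≤ d - 1, so p + l ≤ s - 1 by `hs`.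
      have hmem := hS'.1 ((mem_window _).2 ⟨p + l, by have := hs i; omega, rfl⟩)
      have hidx : (⟨(k + (p + l)) % P.K, Nat.mod_lt _ hK⟩ : Fin P.K) =
          accessed ⟨(k + p) % P.K, hlt⟩ l := by
        simp [accessed, add_assoc]
      rw [← hidx]
      exact hWV _ hmem
    simp only [Strategy.output, hsend, hplace]

/-- The non-cut-set lower bound on achievable rates. -/
theorem Achievable.bound {P : CachingSetup L} {R M : ℝ} (hach : P.Achievable R M) (hM : 0 ≤ M)
    (hK : 0 < P.K) (hN : ∀ i, 0 < P.N i) (s c b n : Fin L → ℕ)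
    (hc : ∀ i, c i ≤ P.K) (hs : ∀ i, 2 * c i + P.d i ≤ s i + 2)
    (hnN : ∀ i, n i ≤ P.N i) (hn : ∀ i, n i ≤ b i * c i * P.U i)
    {A₁ A₂ : Finset (Fin L)} (hA : Disjoint A₁ A₂) {m q : ℕ} (hm : 0 < m) (e : Fin L → ℕ)
    (hs₁ : ∀ i ∈ A₁, 1 ≤ s i ∧ s i < m) (hs₂ : ∀ i ∈ A₂, s i = m * 2 ^ e i)
    (hb : ∀ i ∈ A₂, b i = q * 2 ^ e i) :
    ∑ i ∈ A₁, (n i : ℝ) / s i + ∑ i ∈ A₂, (n i : ℝ) / s i ≤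
      M + (∑ i ∈ A₁, (b i : ℝ) / s i + q / m) * R := by
  obtain ⟨hR, hach⟩ := hach
  have : Nonempty P.Demand := ⟨fun u => ⟨0, hN u.1⟩⟩
  have hD : 0 < Fintype.card P.Demand := Fintype.card_pos
  -- The tolerance required by the union bound in `exists_good_seed`.
  obtain ⟨F₀, hF₀⟩ := hach (1 / (2 * Fintype.card P.Demand)) (by positivity)
  refine le_of_forall_pos_le_add fun ε hε => ?_
  set κ : ℕ := m + ∑ i ∈ A₂, e i + 1 with hκ
  -- The total loss is κ bits with κ independent of F, hence at most ε F bits for large F.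
  obtain ⟨F₁, hF₁⟩ := exists_nat_gt ((κ : ℝ) / ε)
  set F := max F₀ (F₁ + 1) with hF
  have hFpos : (0 : ℝ) < F := by
    have : 0 < F := by omega
    exact_mod_cast this
  obtain ⟨st, hst⟩ := hF₀ F (le_max_left _ _)
  obtain ⟨ω, G, hG, hdec⟩ := st.exists_good_seed hD hst
  have hGne : Nonempty G := by
    have : 0 < Fintype.card (P.Library F) := Fintype.card_pos
    exact Finset.nonempty_coe_sort.2 (Finset.card_pos.1 (by omega))
  have hlog : 0 < Real.log 2 := Real.log_pos (by norm_num)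
  have hb := (P.windowDecoding hK hN st ω G hG hdec s c b n hc hs hnN hn).bound hK hlog.le hA hm e
    hs₁ hs₂ hb
  have e1 : ∀ A : Finset (Fin L), ∑ i ∈ A, (n i : ℝ) * (F * Real.log 2) / s i =
      (∑ i ∈ A, (n i : ℝ) / s i) * (F * Real.log 2) := by
    intro A
    rw [Finset.sum_mul]
    exact Finset.sum_congr rfl fun i _ => by ring
  rw [e1, e1, ← add_mul] at hb
  have hMF : ((⌊M * F⌋₊ : ℕ) : ℝ) ≤ M * F := Nat.floor_le (by positivity)
  have hRF : ((⌊R * F⌋₊ : ℕ) : ℝ) ≤ R * F := Nat.floor_le (by positivity)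
  have hβ : 0 ≤ ∑ i ∈ A₁, (b i : ℝ) / s i + q / m :=
    add_nonneg (Finset.sum_nonneg fun _ _ => by positivity) (by positivity)
  set β := ∑ i ∈ A₁, (b i : ℝ) / s i + q / m
  have hεF : (κ : ℝ) ≤ ε * F := by
    have h1 : (F₁ : ℝ) ≤ F := by
      have : F₁ ≤ F := by omega
      exact_mod_cast this
    rw [div_lt_iff₀ hε] at hF₁
    nlinarith
  have hfin : (∑ i ∈ A₁, (n i : ℝ) / s i + ∑ i ∈ A₂, (n i : ℝ) / s i) * (F * Real.log 2) ≤
      (M + β * R + ε) * (F * Real.log 2) := by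
    have h1 := mul_le_mul_of_nonneg_right hMF hlog.le
    have h2 := mul_le_mul_of_nonneg_left (mul_le_mul_of_nonneg_right hRF hlog.le) hβ
    have h3 := mul_le_mul_of_nonneg_right hεF hlog.le
    linarith
  exact le_of_mul_le_mul_right hfin (by positivity)

end CachingSetup

namespace CachingSetup

variable {L : ℕ}

/-! ### Achievability of some rate -/

theorem Strategy.errorProb_eq_zero {P : CachingSetup L} {F C B : ℕ} (s : P.Strategy F C B)
    (r : P.Demand) (h : ∀ ω W u, s.output ω W r u = W u.1 (r u)) : s.errorProb r = 0 := by
  simp [Strategy.errorProb, h]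

/-- Broadcasting the whole library is a strategy. -/
theorem achievable_sum (P : CachingSetup L) (M : ℝ) :
    P.Achievable ((∑ i, P.N i : ℕ) : ℝ) M := by
  refine ⟨Nat.cast_nonneg _, fun ε hε => ⟨0, fun F _ => ?_⟩⟩
  have hB : ⌊((∑ i, P.N i : ℕ) : ℝ) * F⌋₊ = (∑ i, P.N i) * F := by
    exact_mod_cast Nat.floor_natCast ((∑ i, P.N i) * F)
  have hcard : Fintype.card (P.Library F) ≤
      Fintype.card (Fin ⌊((∑ i, P.N i : ℕ) : ℝ) * F⌋₊ → Bool) := by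
    rw [hB]
    simp [Fintype.card_pi, ← pow_mul, Finset.prod_pow_eq_pow_sum, ← Finset.mul_sum, mul_comm]
  obtain ⟨φ⟩ := Function.Embedding.nonempty_of_card_le hcard
  refine ⟨⟨1, one_pos, fun _ _ _ _ => false, fun _ _ W => φ W,
    fun _ r u _ y => Function.invFun φ y u.1 (r u)⟩, fun r => ?_⟩
  rw [Strategy.errorProb_eq_zero]
  · exact hε.le
  · intro ω W u
    simp [Strategy.output, Function.leftInverse_invFun φ.injective W]

/-- Some rate must be achievable here, since the real infimum of the empty set is 0 by convention.
-/
theorem le_optimalRate (P : CachingSetup L) (M c : ℝ) (h : ∀ R, P.Achievable R M → c ≤ R) :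
    c ≤ P.optimalRate M :=
  le_csInf ⟨_, P.achievable_sum M⟩ h

theorem optimalRate_nonneg (P : CachingSetup L) (M : ℝ) : 0 ≤ P.optimalRate M :=
  P.le_optimalRate M 0 fun _ h => h.1

end CachingSetup

/-! ### Existence of feasible partitions -/

/-- A sum of nondecreasing ramps, with slopes `p i` on `[a i, c i]`, takes each intermediate value
at a point of one of these intervals. -/
theorem exists_sum_clamp_eq {κ : Type*} [Fintype κ] [Nonempty κ] (a c p : κ → ℝ)
    (hac : ∀ i, a i ≤ c i) {M : ℝ} (hM0 : 0 ≤ M) (hM : M ≤ ∑ i, p i * (c i - a i)) :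
    ∃ t : ℝ, (∃ i, a i ≤ t ∧ t ≤ c i) ∧ ∑ i, p i * (max (a i) (min t (c i)) - a i) = M := by
  classical
  obtain ⟨i₀, hi₀⟩ := Finite.exists_min a
  obtain ⟨i₁, hi₁⟩ := Finite.exists_max c
  have hle : a i₀ ≤ c i₁ := (hac i₀).trans (hi₁ i₀)
  have hcont : ContinuousOn (fun t : ℝ => ∑ i, p i * (max (a i) (min t (c i)) - a i))
      (Set.Icc (a i₀) (c i₁)) := by fun_prop
  have h0 : ∑ i, p i * (max (a i) (min (a i₀) (c i)) - a i) = 0 :=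
    Finset.sum_eq_zero fun i _ => by
      rw [max_eq_left ((min_le_left _ _).trans (hi₀ i)), sub_self, mul_zero]
  have h1 : ∑ i, p i * (max (a i) (min (c i₁) (c i)) - a i) = ∑ i, p i * (c i - a i) :=
    Finset.sum_congr rfl fun i _ => by rw [min_eq_right (hi₁ i), max_eq_right (hac i)]
  obtain ⟨t, ht, htM⟩ := intermediate_value_Icc hle hcont
    (show M ∈ Set.Icc _ _ from ⟨h0.le.trans hM0, hM.trans h1.ge⟩)
  by_cases hex : ∃ i, a i ≤ t ∧ t ≤ c i
  · exact ⟨t, hex, htM⟩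
  push Not at hex
  -- Now t lies in a gap between the intervals, where the sum is constant; t may be lowered to the
  -- largest right endpoint below it.
  obtain ⟨j, hj, hjmax⟩ := (Finset.univ.filter fun i => c i < t).exists_max_image c
    ⟨i₀, by simpa using hex i₀ ht.1⟩
  have hj' : c j < t := by simpa using hj
  refine ⟨c j, ⟨j, hac j, le_rfl⟩, ?_⟩
  rw [← htM]
  refine Finset.sum_congr rfl fun i _ => ?_
  by_cases hi : c i < t
  · rw [min_eq_right (hjmax i (by simpa using hi)), min_eq_right hi.le]
  · have hai : t < a i := by
      by_contra! hcon
      exact hi (hex i hcon)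
    rw [max_eq_left ((min_le_left _ _).trans (hj'.le.trans hai.le)),
      max_eq_left ((min_le_left _ _).trans hai.le)]

namespace CachingSetup

variable {L : ℕ}

theorem sqrt_mul_mul_sqrt_div {N U : ℝ} (hN : 0 ≤ N) (hU : 0 < U) : √(N * U) * √(N / U) = N := by
  rw [← Real.sqrt_mul (by positivity), show N * U * (N / U) = N ^ 2 by field_simp,
    Real.sqrt_sq hN]

/-- Water-filling: at level t, level i uses √(N_i U_i) times the length of [a_i, c_i] below t, which
is 0 below a_i and N_i/d_i above c_i. A level t of total memory M that lies in some [a_i, c_i] turns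
out to be M̃, with I nonempty. -/
theorem exists_isFeasible (P : CachingSetup L) (hL : 1 ≤ L) (hK : 0 < P.K) (hN : ∀ i, 0 < P.N i)
    (hU : ∀ i, 0 < P.U i) (hd : ∀ i, 0 < P.d i) {M : ℝ} (hM : 0 ≤ M) :
    ∃ H I J : Finset (Fin L), P.IsFeasible M H I J := by
  classical
  by_cases hMT : P.T Finset.univ < M
  · exact ⟨∅, ∅, Finset.univ, ⟨by simp, by simp, by simp, by simp⟩, Or.inr ⟨rfl, rfl, hMT⟩⟩
  have : Nonempty (Fin L) := ⟨⟨0, hL⟩⟩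
  have hK' : (0 : ℝ) < P.K := by exact_mod_cast hK
  have hN' : ∀ i, (0 : ℝ) < P.N i := fun i => by exact_mod_cast hN i
  have hU' : ∀ i, (0 : ℝ) < P.U i := fun i => by exact_mod_cast hU i
  have hd' : ∀ i, (0 : ℝ) < P.d i := fun i => by exact_mod_cast hd i
  have hprod : ∀ i, √((P.N i : ℝ) * P.U i) * √((P.N i : ℝ) / P.U i) = P.N i := fun i =>
    sqrt_mul_mul_sqrt_div (hN' i).le (hU' i)
  set p : Fin L → ℝ := fun i => √((P.N i : ℝ) * P.U i) with hp
  set a : Fin L → ℝ := fun i => 1 / P.K * √((P.N i : ℝ) / P.U i) with ha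
  set c : Fin L → ℝ := fun i => (1 / P.d i + 1 / P.K) * √((P.N i : ℝ) / P.U i) with hc
  have hpa : ∀ i, p i * a i = P.N i / P.K := fun i => by
    have := hprod i
    simp only [hp, ha]
    rw [mul_left_comm, this]; ring
  have hpc : ∀ i, p i * (c i - a i) = P.N i / P.d i := fun i => by
    have := hprod i
    simp only [hp, ha, hc]
    rw [show ∀ y z w v : ℝ, y * ((z + w) * v - w * v) = z * (y * v) by intros; ring, this]; ring
  have hac : ∀ i, a i ≤ c i := fun i => by
    simp only [ha, hc]
    have := hd' i
    gcongr
    simp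
  obtain ⟨t, ⟨i, hi⟩, ht⟩ := exists_sum_clamp_eq a c p hac hM (by
    simp_rw [hpc]
    exact not_lt.1 hMT)
  set H := Finset.univ.filter fun i => t < a i with hH
  set I := Finset.univ.filter fun i => a i ≤ t ∧ t ≤ c i with hI
  set J := Finset.univ.filter fun i => c i < t with hJ
  have hHI : Disjoint H I := by
    rw [Finset.disjoint_filter]; intro i _ h1 h2; linarith [h2.1]
  have hHJ : Disjoint H J := by
    rw [Finset.disjoint_filter]; intro i _ h1 h2; linarith [hac i]
  have hIJ : Disjoint I J := by
    rw [Finset.disjoint_filter]; intro i _ h1 h2; linarith [h1.2]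
  have hunion : H ∪ I ∪ J = Finset.univ := by
    ext i
    simp only [hH, hI, hJ, Finset.mem_union, Finset.mem_filter, Finset.mem_univ, true_and, iff_true]
    rcases lt_or_ge t (a i) with h1 | h1
    · exact Or.inl (Or.inl h1)
    · rcases le_or_gt t (c i) with h2 | h2
      · exact Or.inl (Or.inr ⟨h1, h2⟩)
      · exact Or.inr h2
  have hIne : I.Nonempty := ⟨i, by simp [hI, hi]⟩
  have hSpos : 0 < P.S I := Finset.sum_pos (fun i _ =>
    Real.sqrt_pos.2 (mul_pos (hN' i) (hU' i))) hIne
  have htilde : P.tildeM M I J = t := by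
    rw [tildeM, div_eq_iff hSpos.ne', ← ht, ← hunion, Finset.sum_union
      (Finset.disjoint_union_left.2 ⟨hHJ, hIJ⟩), Finset.sum_union hHI]
    have e1 : ∑ i ∈ H, p i * (max (a i) (min t (c i)) - a i) = 0 :=
      Finset.sum_eq_zero fun i hi => by
        rw [max_eq_left ((min_le_left _ _).trans (Finset.mem_filter.1 hi).2.le), sub_self, mul_zero]
    have e2 : ∑ i ∈ I, p i * (max (a i) (min t (c i)) - a i) = t * P.S I - P.V I := by
      rw [S, V, Finset.mul_sum, ← Finset.sum_sub_distrib]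
      refine Finset.sum_congr rfl fun i hi => ?_
      have := (Finset.mem_filter.1 hi).2
      rw [min_eq_left this.2, max_eq_right this.1, mul_sub, hpa, mul_comm t]
    have e3 : ∑ i ∈ J, p i * (max (a i) (min t (c i)) - a i) = P.T J :=
      Finset.sum_congr rfl fun i hi => by
        rw [min_eq_right (Finset.mem_filter.1 hi).2.le, max_eq_right (hac i), hpc]
    rw [e1, e2, e3]
    ring
  refine ⟨H, I, J, ⟨hHI, hHJ, hIJ, hunion⟩, Or.inl ⟨hIne, ?_, ?_, ?_⟩⟩ <;> rw [htilde]
  · exact fun i hi => (Finset.mem_filter.1 hi).2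
  · exact fun i hi => (Finset.mem_filter.1 hi).2
  · exact fun i hi => (Finset.mem_filter.1 hi).2

end CachingSetup

/-! ### Choice of the parameters in the converse bound -/

theorem exists_pow_two_mul_near {m : ℕ} (hm : 0 < m) {y : ℝ} (hy : m ≤ y) :
    ∃ e : ℕ, ((m * 2 ^ e : ℕ) : ℝ) ≤ y ∧ y < 2 * ((m * 2 ^ e : ℕ) : ℝ) := by
  have hm' : (0 : ℝ) < m := by exact_mod_cast hm
  obtain ⟨e, h1, h2⟩ := exists_nat_pow_near (one_le_div₀ hm' |>.2 hy) (one_lt_two (α := ℝ))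
  rw [le_div_iff₀ hm'] at h1
  rw [div_lt_iff₀ hm', pow_succ] at h2
  exact ⟨e, by push_cast; linarith, by push_cast; linarith⟩

theorem natCast_div_four_add_one_ge (s : ℕ) : (s : ℝ) / 4 ≤ ((s / 4 + 1 : ℕ) : ℝ) := by
  have h : (s : ℝ) ≤ ((4 * (s / 4 + 1) : ℕ) : ℝ) := by
    exact_mod_cast (by omega : s ≤ 4 * (s / 4 + 1))
  push_cast at h ⊢
  linarith

/-- A level decoded from the `d` caches of a single user. -/
theorem exists_parameters_single_user {N U : ℕ} {x : ℝ} (hx : 1 ≤ x) (hN : (N : ℝ) = U * x ^ 2) :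
    ∃ b : ℕ, N ≤ b * 1 * U ∧ (b : ℝ) ≤ 2 * x ^ 2 := by
  have hx2 : 1 ≤ x ^ 2 := one_le_pow₀ hx
  refine ⟨⌈x ^ 2⌉₊, ?_, ?_⟩
  · have h := mul_le_mul_of_nonneg_left (Nat.le_ceil (x ^ 2)) (Nat.cast_nonneg (α := ℝ) U)
    rw [← hN] at h
    have : (N : ℝ) ≤ ((⌈x ^ 2⌉₊ * 1 * U : ℕ) : ℝ) := by push_cast; linarith
    exact_mod_cast this
  · linarith [Nat.ceil_lt_add_one (a := x ^ 2) (by positivity)]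

/-- A level decoded from about `x / (2 t)` caches. -/
theorem exists_parameters_window {K N U d : ℕ} {x t : ℝ} (ht : 0 < t) (hx : 0 < x) (hd : 1 ≤ d)
    (hN : (N : ℝ) = U * x ^ 2) (hxd : 8 * d * t ≤ x) (hxK : x ≤ K * t) (hxt : 1 ≤ x * t) :
    ∃ s c b : ℕ, c ≤ K ∧ 2 * c + d ≤ s + 2 ∧ N ≤ b * c * U ∧ 1 ≤ s ∧ (s : ℝ) ≤ x / (2 * t) ∧
      (b : ℝ) / s ≤ 32 * t ^ 2 := by
  set y := x / (2 * t) with hy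
  have hxy : x = 2 * t * y := by rw [hy]; field_simp
  have hy4 : (4 * d : ℝ) ≤ y := by rw [hy, le_div_iff₀ (by positivity)]; linarith
  have hyK : y ≤ K / 2 := by rw [hy, div_le_iff₀ (by positivity)]; linarith
  have hy0 : 0 < y := by positivity
  set s := ⌊y⌋₊ with hs
  have hs4 : 4 * d ≤ s := Nat.le_floor (by push_cast; exact hy4)
  have hsy : (s : ℝ) ≤ y := Nat.floor_le hy0.le
  have hsy' : y < s + 1 := Nat.lt_floor_add_one y
  have hsK : 2 * s ≤ K := by
    have : ((2 * s : ℕ) : ℝ) ≤ K := by push_cast; linarith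
    exact_mod_cast this
  have hs4' : (4 : ℝ) ≤ s := by exact_mod_cast (by omega : 4 ≤ s)
  have hys : y ≤ 4 / 3 * s := by linarith
  set c := s / 4 + 1 with hc
  have hc4 : (s : ℝ) / 4 ≤ c := natCast_div_four_add_one_ge s
  have hc0 : (0 : ℝ) < c := by linarith
  refine ⟨s, c, ⌈x ^ 2 / c⌉₊, by omega, by omega, ?_, by omega, hsy, ?_⟩
  · have h := Nat.le_ceil (x ^ 2 / c)
    rw [div_le_iff₀ hc0] at h
    have h' := mul_le_mul_of_nonneg_right h (Nat.cast_nonneg (α := ℝ) U)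
    have : (N : ℝ) ≤ ((⌈x ^ 2 / c⌉₊ * c * U : ℕ) : ℝ) := by push_cast; linarith
    exact_mod_cast this
  · have hs0 : (0 : ℝ) < s := by linarith
    have hxs : x ≤ 8 / 3 * (s * t) := by rw [hxy]; nlinarith
    have h1 : x ^ 2 / c ≤ 4 * (x ^ 2 / s) := by
      rw [div_le_iff₀ hc0]
      calc x ^ 2 = 4 * (x ^ 2 / s) * (s / 4) := by field_simp
        _ ≤ _ := by gcongr
    have h2 := Nat.ceil_lt_add_one (a := x ^ 2 / c) (by positivity)
    have h3 : x ^ 2 / s ≤ 64 / 9 * (s * t ^ 2) := by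
      rw [div_le_iff₀ hs0]
      calc x ^ 2 ≤ (8 / 3 * (s * t)) ^ 2 := by gcongr
        _ = _ := by ring
    -- From 1 ≤ x t; it absorbs the rounding of b. In total 4 · 64/9 + 8/3 < 32.
    have h4 : 1 ≤ 8 / 3 * (s * t ^ 2) := by nlinarith
    rw [div_le_iff₀ hs0]
    linarith

/-- Base block of the nested blocks: `m` caches and `q` broadcasts, with `q / m` about `t ^ 2`. -/
theorem exists_base_block {D : ℕ} {t : ℝ} (ht : 0 < t) (hD : 1 ≤ D) :
    ∃ m q : ℕ, 2 * D ≤ m ∧ ((m : ℝ) ≤ 2 * D ∨ (m : ℝ) ≤ 1 / (2 * t ^ 2)) ∧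
      64 * t ^ 2 * m ≤ q ∧ (q : ℝ) / m ≤ 68 * t ^ 2 := by
  set y := 1 / (2 * t ^ 2) with hy
  have hyt : y * t ^ 2 = 1 / 2 := by rw [hy]; field_simp
  have hy0 : 0 < y := by positivity
  set m := max (2 * D) ⌊y⌋₊ with hm
  have hm2 : 2 * D ≤ m := le_max_left _ _
  have hm2' : (2 : ℝ) ≤ m := by exact_mod_cast (by omega : 2 ≤ m)
  have hmy : y ≤ 2 * m := by
    have h1 := Nat.lt_floor_add_one y
    have h2 : ((⌊y⌋₊ : ℕ) : ℝ) ≤ m := by exact_mod_cast le_max_right (2 * D) ⌊y⌋₊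
    linarith
  -- Rounding q up costs at most 1 ≤ 4 t² m, whence 68 = 64 + 4.
  have hmt : 1 / 4 ≤ t ^ 2 * m := by
    have := mul_le_mul_of_nonneg_right hmy (sq_nonneg t)
    linarith
  refine ⟨m, ⌈64 * t ^ 2 * m⌉₊, hm2, ?_, Nat.le_ceil _, ?_⟩
  · rcases max_choice (2 * D) ⌊y⌋₊ with h | h
    · left; rw [hm, h]; push_cast; exact le_rfl
    · right; rw [hm, h]; exact Nat.floor_le hy0.le
  · rw [div_le_iff₀ (by linarith)]
    linarith [Nat.ceil_lt_add_one (a := 64 * t ^ 2 * m) (by positivity)]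

/-- A level decoded completely from a nested block. -/
theorem exists_parameters_nested {K N U d D m q : ℕ} {x t : ℝ} (ht : 0 < t) (hx : 0 < x)
    (hd : d ≤ D) (hD : 1 ≤ D) (hN : (N : ℝ) = U * x ^ 2) (hxK : x ≤ K * t) (hm : 2 * D ≤ m)
    (hq : 64 * t ^ 2 * m ≤ q) (hmx : m ≤ x / (2 * t)) :
    ∃ s c b e : ℕ, c ≤ K ∧ 2 * c + d ≤ s + 2 ∧ N ≤ b * c * U ∧ (s : ℝ) ≤ x / (2 * t) ∧
      s = m * 2 ^ e ∧ b = q * 2 ^ e ∧ 0 < s := by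
  obtain ⟨e, he1, he2⟩ := exists_pow_two_mul_near (by omega) hmx
  set s := m * 2 ^ e with hs
  have hsm : m ≤ s := Nat.le_mul_of_pos_right _ (by positivity)
  -- The 2c - 1 starting caches take about half of the window; the other half has room for d, since
  -- 2d ≤ 2D ≤ m ≤ s.
  set c := s / 4 + 1 with hc
  have hc4 : (s : ℝ) / 4 ≤ c := natCast_div_four_add_one_ge s
  have hsK : 2 * s ≤ K := by
    have h1 : x / (2 * t) ≤ K / 2 := by rw [div_le_iff₀ (by positivity)]; linarith
    have : ((2 * s : ℕ) : ℝ) ≤ K := by push_cast; linarith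
    exact_mod_cast this
  refine ⟨s, c, q * 2 ^ e, e, by omega, by omega, ?_, he1, rfl, rfl, by omega⟩
  have hb : 64 * t ^ 2 * s ≤ ((q * 2 ^ e : ℕ) : ℝ) := by
    have := mul_le_mul_of_nonneg_right hq (by positivity : (0 : ℝ) ≤ 2 ^ e)
    rw [hs]; push_cast; linarith
  have hxs : x ≤ 4 * t * s := by
    rw [div_lt_iff₀ (by positivity)] at he2; linarith
  have h1 : x ^ 2 ≤ ((q * 2 ^ e : ℕ) : ℝ) * c := by
    calc x ^ 2 ≤ (4 * t * s) ^ 2 := by gcongr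
      _ = (64 * t ^ 2 * s) * (s / 4) := by ring
      _ ≤ _ := by gcongr
  have h2 := mul_le_mul_of_nonneg_right h1 (Nat.cast_nonneg (α := ℝ) U)
  have : (N : ℝ) ≤ ((q * 2 ^ e * c * U : ℕ) : ℝ) := by push_cast at h2 ⊢; linarith
  exact_mod_cast this

/-- A level that is too large to be decoded completely. -/
theorem exists_parameters_large {K N U d D m q : ℕ} {x t : ℝ} (ht : 0 < t)
    (hd : d ≤ D) (hD : 1 ≤ D) (hN : (N : ℝ) = U * x ^ 2) (hxK : K * t ≤ x) (hm : 2 * D ≤ m)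
    (hq : 64 * t ^ 2 * m ≤ q) (hmK : m ≤ 2 * K) :
    ∃ s c b n e : ℕ, c ≤ K ∧ 2 * c + d ≤ s + 2 ∧ n ≤ N ∧ n ≤ b * c * U ∧
      s = m * 2 ^ e ∧ b = q * 2 ^ e ∧ (K * U * t ^ 2 / 2 : ℝ) ≤ n / s := by
  -- The bound is 2K rather than K because m ≥ 2D may exceed K; longer windows just wrap around the
  -- cycle.
  obtain ⟨e, he1, he2⟩ := exists_pow_two_mul_near (m := m) (y := ((2 * K : ℕ) : ℝ)) (by omega)
    (by exact_mod_cast hmK)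
  set s := m * 2 ^ e with hs
  have hsm : m ≤ s := Nat.le_mul_of_pos_right _ (by positivity)
  have hs1 : s ≤ 2 * K := by exact_mod_cast he1
  have hs2 : (K : ℝ) ≤ s := by push_cast at he2; linarith
  have hs0 : (0 : ℝ) < s := by exact_mod_cast (by omega : 0 < s)
  set c := s / 4 + 1 with hc
  have hc4 : (s : ℝ) / 4 ≤ c := natCast_div_four_add_one_ge s
  refine ⟨s, c, q * 2 ^ e, min N (q * 2 ^ e * c * U), e, by omega, by omega, min_le_left _ _,
    min_le_right _ _, rfl, rfl, ?_⟩
  have hb : 64 * t ^ 2 * s ≤ ((q * 2 ^ e : ℕ) : ℝ) := by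
    have := mul_le_mul_of_nonneg_right hq (by positivity : (0 : ℝ) ≤ 2 ^ e)
    rw [hs]; push_cast; linarith
  have hU0 : (0 : ℝ) ≤ U := Nat.cast_nonneg U
  have hK0 : (0 : ℝ) ≤ K := Nat.cast_nonneg K
  rw [le_div_iff₀ hs0, Nat.cast_min, le_min_iff]
  constructor
  · rw [hN]
    have h1 : (s : ℝ) ≤ 2 * K := by exact_mod_cast hs1
    calc (K * U * t ^ 2 / 2 * s : ℝ) ≤ K * U * t ^ 2 / 2 * (2 * K) := by gcongr
      _ = U * (K * t) ^ 2 := by ring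
      _ ≤ _ := by gcongr
  · calc (K * U * t ^ 2 / 2 * s : ℝ) ≤ 16 * (K * U * t ^ 2 * s) := by
          have : (0 : ℝ) ≤ K * U * t ^ 2 * s := by positivity
          linarith
      _ ≤ 16 * (s * U * t ^ 2 * s) := by gcongr
      _ = (64 * t ^ 2 * s) * (s / 4) * U := by ring
      _ ≤ ((q * 2 ^ e : ℕ) : ℝ) * c * U := by gcongr
      _ = _ := by push_cast; ring

/-! ### The rates of the individual levels -/

namespace CachingSetup

/-- The rate of a level that is neither uncached nor completely cached. -/
theorem singleLevelRate_le {K N U d : ℕ} {x t : ℝ} (hK : 0 < K) (hU : 0 < U) (hd : 0 < d)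
    (hx : 0 < x) (ht : 0 < t) (hN : (N : ℝ) = U * x ^ 2) (hxK : x ≤ K * t)
    (hxd : t ≤ (1 / d + 1 / K) * x) :
    0 ≤ U * x * (t - x / K) ∧ 0 ≤ 1 - d * (U * x * (t - x / K)) / N ∧
      singleLevelRate (U * x * (t - x / K)) K N U d ≤
        2 * U * x / t * (1 - d * (U * x * (t - x / K)) / N) := by
  have hK' : (0 : ℝ) < K := by exact_mod_cast hK
  have hU' : (0 : ℝ) < U := by exact_mod_cast hU
  have hd' : (0 : ℝ) < d := by exact_mod_cast hd
  have hN0 : (0 : ℝ) < N := by rw [hN]; positivity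
  have h0 : 0 ≤ t - x / K := by rw [sub_nonneg, div_le_iff₀ hK']; linarith
  have h1 : 0 ≤ 1 - d * (U * x * (t - x / K)) / N := by
    rw [sub_nonneg, div_le_one hN0, hN]
    have h2 : t - x / K ≤ x / d := by
      have : (1 / (d : ℝ) + 1 / K) * x = x / d + x / K := by ring
      linarith
    calc d * (U * x * (t - x / K)) ≤ d * (U * x * (x / d)) := by gcongr
      _ = _ := by field_simp
  refine ⟨by positivity, h1, ?_⟩
  unfold singleLevelRate
  refine mul_le_mul_of_nonneg_right ?_ h1
  rw [show 2 * (U : ℝ) * x / t = U * (x * 2 / t) by ring]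
  refine mul_le_mul_of_nonneg_left ?_ hU'.le
  have hcap : K * t ≤ 2 * x → (K : ℝ) ≤ x * 2 / t := fun h => by
    rw [le_div_iff₀ ht]; linarith
  have hhalf : 2 * x < K * t → t / 2 ≤ t - x / K := fun h => by
    have : x / K ≤ t / 2 := by rw [div_le_iff₀ hK']; linarith
    linarith
  -- Either K itself is at most 2x/t, or x/K ≤ t/2, so the memory is at least U x t / 2 and N/m ≤
  -- 2x/t.
  rcases le_or_gt (K * t) (2 * x) with h | h
  · split_ifs
    · exact hcap h
    · exact (min_le_right _ _).trans (hcap h)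
  · have h2 := hhalf h
    have hpos : 0 < U * x * (t - x / K) := mul_pos (mul_pos hU' hx) (by linarith)
    rw [if_neg hpos.ne']
    refine (min_le_left _ _).trans ?_
    rw [div_le_div_iff₀ hpos ht, hN]
    calc U * x ^ 2 * t = x * 2 * (U * x * (t / 2)) := by ring
      _ ≤ _ := by gcongr

theorem singleLevelRate_zero (K N U d : ℕ) : singleLevelRate 0 K N U d = K * U := by
  simp [singleLevelRate, mul_comm]

theorem singleLevelRate_full {K N U d : ℕ} (hN : 0 < N) (hd : 0 < d) :
    singleLevelRate (N / d) K N U d = 0 := by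
  have hN' : (N : ℝ) ≠ 0 := by exact_mod_cast hN.ne'
  have hd' : (d : ℝ) ≠ 0 := by exact_mod_cast hd.ne'
  have : (1 : ℝ) - d * (N / d) / N = 0 := by field_simp; ring
  simp [singleLevelRate, this]

/-! ### Separation of the levels -/

/-- If the members of a finite family of nonnegative numbers are separated by a factor of at least
two, the sum of the squares is at most twice the square of the largest. -/
theorem sum_sq_le_of_separated {κ : Type*} [DecidableEq κ] (x : κ → ℝ) (A : Finset κ)
    (hx : ∀ i ∈ A, 0 ≤ x i) (hsep : ∀ i ∈ A, ∀ j ∈ A, i ≠ j → x i ≤ x j → 2 * x i ≤ x j) {y : ℝ}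
    (hy : 0 ≤ y) (hA : ∀ i ∈ A, x i ≤ y) : ∑ i ∈ A, x i ^ 2 ≤ 2 * y ^ 2 := by
  induction A using Finset.induction_on_max_value x generalizing y with
  | empty => simp; positivity
  | insert a A ha hmax ih =>
    rw [Finset.sum_insert ha]
    have ha0 := hx a (Finset.mem_insert_self a A)
    have hay := hA a (Finset.mem_insert_self a A)
    -- All members but the largest are at most half of it, and y² + 2 (y/2)² ≤ 2 y².
    have h1 := ih (fun i hi => hx i (Finset.mem_insert_of_mem hi))
      (fun i hi j hj => hsep i (Finset.mem_insert_of_mem hi) j (Finset.mem_insert_of_mem hj))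
      (y := x a / 2) (by positivity) (fun i hi => by
        have := hsep i (Finset.mem_insert_of_mem hi) a (Finset.mem_insert_self a A)
          (fun h => ha (h ▸ hi)) (hmax i hi)
        linarith)
    have h2 : x a ^ 2 ≤ y ^ 2 := by gcongr
    nlinarith

/-- Controls the broadcasts spent on J. The largest member contributes at most D t²; separation by
198 D puts all others below t/198, where the squares sum geometrically without a further factor D.
-/
theorem sum_sq_div_le_of_separated {κ : Type*} [DecidableEq κ] (x : κ → ℝ) (d : κ → ℕ)
    (A : Finset κ) {D : ℕ} {t : ℝ} (ht : 0 < t) (hD : 1 ≤ D) (hx : ∀ i ∈ A, 0 ≤ x i)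
    (hd : ∀ i ∈ A, 1 ≤ d i ∧ d i ≤ D) (hxd : ∀ i ∈ A, x i ≤ d i * t)
    (hsep : ∀ i ∈ A, ∀ j ∈ A, i ≠ j → x i ≤ x j → 198 * D * x i ≤ x j) :
    ∑ i ∈ A, x i ^ 2 / d i ≤ 2 * D * t ^ 2 := by
  have hD' : (1 : ℝ) ≤ D := by exact_mod_cast hD
  rcases A.eq_empty_or_nonempty with rfl | hne
  · simp; positivity
  obtain ⟨a, ha, hmax⟩ := A.exists_max_image x hne
  have hda : (1 : ℝ) ≤ d a ∧ (d a : ℝ) ≤ D := by exact_mod_cast hd a ha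
  rw [← Finset.add_sum_erase A _ ha]
  have h1 : x a ^ 2 / d a ≤ D * t ^ 2 := by
    rw [div_le_iff₀ (by linarith)]
    calc x a ^ 2 ≤ (d a * t) ^ 2 := by
          have := hx a ha; have := hxd a ha; gcongr
      _ = d a * t ^ 2 * d a := by ring
      _ ≤ _ := by gcongr; exact_mod_cast hda.2
  have h2 : ∑ i ∈ A.erase a, x i ^ 2 / d i ≤ ∑ i ∈ A.erase a, x i ^ 2 :=
    Finset.sum_le_sum fun i hi => by
      have : (1 : ℝ) ≤ d i := by exact_mod_cast (hd i (Finset.mem_of_mem_erase hi)).1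
      exact div_le_self (sq_nonneg _) this
  have h3 : ∑ i ∈ A.erase a, x i ^ 2 ≤ 2 * (t / 198) ^ 2 := by
    refine sum_sq_le_of_separated x _ (fun i hi => hx i (Finset.mem_of_mem_erase hi)) ?_
      (by positivity) ?_
    · intro i hi j hj hij hle
      have := hsep i (Finset.mem_of_mem_erase hi) j (Finset.mem_of_mem_erase hj) hij hle
      have := hx i (Finset.mem_of_mem_erase hi)
      nlinarith
    · intro i hi
      have hiA := Finset.mem_of_mem_erase hi
      have h4 := hsep i hiA a ha (Finset.ne_of_mem_erase hi) (hmax i hiA)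
      have h5 : x a ≤ D * t := (hxd a ha).trans (by gcongr; exact_mod_cast hda.2)
      have h6 : D * (198 * x i) ≤ D * t := by linarith
      linarith [le_of_mul_le_mul_left h6 (by linarith)]
  nlinarith [sq_nonneg t]

end CachingSetup

/-! ### Comparison of the memory-sharing rate with the converse -/

namespace CachingSetup

variable {L : ℕ}

/-- The inverse square root of the popularity. -/
noncomputable def scale (P : CachingSetup L) (i : Fin L) : ℝ := √((P.N i : ℝ) / P.U i)

theorem scale_pos {P : CachingSetup L} (hN : ∀ i, 0 < P.N i) (hU : ∀ i, 0 < P.U i) (i : Fin L) :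
    0 < P.scale i := by
  have h1 : (0 : ℝ) < P.N i := by exact_mod_cast hN i
  have h2 : (0 : ℝ) < P.U i := by exact_mod_cast hU i
  exact Real.sqrt_pos.2 (div_pos h1 h2)

theorem natCast_files_eq {P : CachingSetup L} (hU : ∀ i, 0 < P.U i) (i : Fin L) :
    (P.N i : ℝ) = P.U i * P.scale i ^ 2 := by
  have h2 : (0 : ℝ) < P.U i := by exact_mod_cast hU i
  rw [scale, Real.sq_sqrt (by positivity)]
  field_simp

theorem sqrt_mul_eq {P : CachingSetup L} (hN : ∀ i, 0 < P.N i) (hU : ∀ i, 0 < P.U i) (i : Fin L) :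
    √((P.N i : ℝ) * P.U i) = P.U i * P.scale i := by
  rw [natCast_files_eq hU i, show (P.U i : ℝ) * P.scale i ^ 2 * P.U i =
    (P.U i * P.scale i) ^ 2 by ring]
  exact Real.sqrt_sq (mul_nonneg (Nat.cast_nonneg _) (scale_pos hN hU i).le)

theorem scale_separated {P : CachingSetup L} (hN : ∀ i, 0 < P.N i) (hU : ∀ i, 0 < P.U i)
    (hsep : P.LevelsSeparated) {i j : Fin L} (hij : i ≠ j) (hle : P.scale i ≤ P.scale j) :
    198 * (P.D : ℝ) * P.scale i ≤ P.scale j := by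
  have hpop : ∀ i, P.popularity i = 1 / P.scale i ^ 2 := fun i => by
    have h2 : (0 : ℝ) < P.U i := by exact_mod_cast hU i
    have := scale_pos hN hU i
    rw [popularity, natCast_files_eq hU i]
    field_simp
  have hi := scale_pos hN hU i
  have hj := scale_pos hN hU j
  have h := hsep i j hij (by rw [hpop, hpop]; gcongr)
  rw [hpop, hpop, show 1 / P.scale i ^ 2 / (1 / P.scale j ^ 2) = (P.scale j / P.scale i) ^ 2 by
    field_simp, Real.sqrt_sq (by positivity), le_div_iff₀ hi] at h
  exact h

/-- The memory of an intermediate level, in terms of its scale. -/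
noncomputable def sharedMemory (P : CachingSetup L) (t : ℝ) (i : Fin L) : ℝ :=
  P.U i * P.scale i * (t - P.scale i / P.K)

/-- The comparison of the memory-sharing rate with an achievable rate, when some level has an
intermediate amount of memory. -/
theorem Achievable.memorySharingRate_le {P : CachingSetup L} (hvalid : P.Valid)
    (hfiles : P.MoreFilesThanUsers) (hsep : P.LevelsSeparated) {R M : ℝ}
    (hach : P.Achievable R M) (hM : 0 ≤ M) {H I J : Finset (Fin L)} (hpart : IsPartition H I J)
    (hIne : I.Nonempty) (hH : ∀ h ∈ H, P.tildeM M I J < 1 / P.K * √((P.N h : ℝ) / P.U h))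
    (hI : ∀ i ∈ I, 1 / P.K * √((P.N i : ℝ) / P.U i) ≤ P.tildeM M I J ∧
        P.tildeM M I J ≤ (1 / P.d i + 1 / P.K) * √((P.N i : ℝ) / P.U i))
    (hJ : ∀ j ∈ J, (1 / P.d j + 1 / P.K) * √((P.N j : ℝ) / P.U j) < P.tildeM M I J) :
    P.memorySharingRate M H I J ≤ 9909 * (P.D : ℝ) * R := by
  classical
  have hR := hach.1
  obtain ⟨hL, hU, hd⟩ := hvalid
  have hK : 0 < P.K := (hd ⟨0, hL⟩).1.trans (hd ⟨0, hL⟩).2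
  have hN : ∀ i, 0 < P.N i := fun i =>
    (Nat.mul_pos hK (hU i)).trans_le (hfiles i)
  have hdD : ∀ i, P.d i ≤ P.D := fun i => Finset.le_sup (f := P.d) (Finset.mem_univ i)
  have hD : 1 ≤ P.D := (hd ⟨0, hL⟩).1.trans (hdD _)
  have hDK : P.D ≤ P.K := Finset.sup_le fun i _ => (hd i).2
  set t := P.tildeM M I J with ht_def
  set x := P.scale with hx_def
  have hK' : (0 : ℝ) < P.K := by exact_mod_cast hK
  have hD' : (1 : ℝ) ≤ P.D := by exact_mod_cast hD
  have hx : ∀ i, 0 < x i := scale_pos hN hU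
  have hNx : ∀ i, (P.N i : ℝ) = P.U i * x i ^ 2 := natCast_files_eq hU
  have hU' : ∀ i, (0 : ℝ) < P.U i := fun i => by exact_mod_cast hU i
  have hd' : ∀ i, (0 : ℝ) < P.d i := fun i => by exact_mod_cast (hd i).1
  have hN' : ∀ i, (0 : ℝ) < P.N i := fun i => by exact_mod_cast hN i
  -- This is N ≥ KU in terms of x. It yields K t² ≥ 1 and x t ≥ 1 on I, which keep the base block
  -- small enough and pay for roundings.
  have hxK2 : ∀ i, (P.K : ℝ) ≤ x i ^ 2 := fun i => by
    have h1 : (P.K : ℝ) * P.U i ≤ P.N i := by exact_mod_cast hfiles i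
    rw [hNx, mul_comm] at h1
    exact le_of_mul_le_mul_left h1 (hU' i)
  have hx1 : ∀ i, 1 ≤ x i := fun i => by
    have h1 : (1 : ℝ) ≤ P.K := by exact_mod_cast hK
    have h2 := h1.trans (hxK2 i)
    nlinarith [hx i]
  have hHx : ∀ i ∈ H, P.K * t ≤ x i := fun i hi => by
    have := hH i hi
    change t < 1 / P.K * x i at this
    rw [one_div, inv_mul_eq_div, lt_div_iff₀ hK'] at this
    linarith
  have hIx : ∀ i ∈ I, x i ≤ P.K * t := fun i hi => by
    have := (hI i hi).1
    change 1 / P.K * x i ≤ t at this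
    rw [one_div, inv_mul_eq_div, div_le_iff₀ hK'] at this
    linarith
  have hIx' : ∀ i ∈ I, t ≤ (1 / P.d i + 1 / P.K) * x i := fun i hi => (hI i hi).2
  obtain ⟨i₀, hi₀⟩ := hIne
  have ht : 0 < t := pos_of_mul_pos_right ((hx i₀).trans_le (hIx i₀ hi₀)) hK'.le
  have hKt : 1 ≤ P.K * t ^ 2 := by
    have h1 : (P.K : ℝ) ≤ (P.K * t) ^ 2 := (hxK2 i₀).trans (by
      have := hx i₀; have := hIx i₀ hi₀; gcongr)
    have h2 : P.K * 1 ≤ P.K * (P.K * t ^ 2) := by linarith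
    exact le_of_mul_le_mul_left h2 hK'
  have hxt : ∀ i ∈ I, 1 ≤ x i * t := fun i hi => by
    have h1 : P.K * 1 ≤ P.K * (x i * t) := by
      have := hxK2 i; have := hx i; have := hIx i hi; nlinarith
    exact le_of_mul_le_mul_left h1 hK'
  have hIdt : ∀ i ∈ I, P.d i * t ≤ 2 * x i := fun i hi => by
    have h1 : (P.d i : ℝ) ≤ P.K := by exact_mod_cast (hd i).2
    have h2 : (1 / P.d i + 1 / P.K) * x i ≤ 2 * x i / P.d i := by
      rw [show 2 * x i / P.d i = (1 / P.d i + 1 / P.d i) * x i by ring]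
      have := hx i; have := hd' i
      gcongr
    have h3 := (hIx' i hi).trans h2
    rw [le_div_iff₀ (hd' i)] at h3
    linarith
  have hJx : ∀ i ∈ J, x i ≤ P.d i * t := fun i hi => by
    have h1 : (1 / P.d i + 1 / P.K) * x i < t := hJ i hi
    have h2 : 0 ≤ 1 / P.K * x i := by have := hx i; positivity
    have h3 : x i / P.d i ≤ t := by rw [add_mul, one_div, inv_mul_eq_div] at h1; linarith
    rw [div_le_iff₀ (hd' i)] at h3
    linarith
  -- the split of the intermediate levels
  obtain ⟨hHI, hHJ, hIJ, hunion⟩ := hpart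
  set I₀ := I.filter fun i => x i < 4 * P.D * t with hI₀
  set I₁ := I.filter fun i => ¬ x i < 4 * P.D * t with hI₁
  have hI₀I : I₀ ⊆ I := Finset.filter_subset _ _
  have hI₁I : I₁ ⊆ I := Finset.filter_subset _ _
  have hI01 : Disjoint I₀ I₁ := Finset.disjoint_filter_filter_not _ _ _
  have hI01' : I₀ ∪ I₁ = I := Finset.filter_union_filter_not_eq _ _
  -- For two such levels, 198 D x_i ≤ x_j < 4 D t ≤ 8 D x_i, a contradiction.
  have hI₀card : I₀.card ≤ 1 := by
    rw [Finset.card_le_one]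
    have key : ∀ i ∈ I₀, ∀ j ∈ I₀, x i ≤ x j → i = j := by
      intro i hi j hj hle
      by_contra hij
      have h1 := scale_separated hN hU hsep hij hle
      have h2 := hIdt i (hI₀I hi)
      have h3 := (Finset.mem_filter.1 hj).2
      have h4 : (1 : ℝ) ≤ P.d i := by exact_mod_cast (hd i).1
      have h5 : t ≤ 2 * x i := by nlinarith
      change 198 * (P.D : ℝ) * x i ≤ x j at h1
      nlinarith
    intro i hi j hj
    rcases le_total (x i) (x j) with h | h
    · exact key i hi j hj h
    · exact (key j hj i hi h).symm
  set μ := P.sharedMemory t with hμ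
  have hμI : ∀ i ∈ I, 0 ≤ μ i ∧ 0 ≤ 1 - P.d i * μ i / P.N i ∧
      singleLevelRate (μ i) P.K (P.N i) (P.U i) (P.d i) ≤
        2 * P.U i * x i / t * (1 - P.d i * μ i / P.N i) := fun i hi =>
    singleLevelRate_le hK (hU i) (hd i).1 (hx i) ht (hNx i) (hIx i hi) (hIx' i hi)
  have hμt : ∀ i, μ i ≤ P.U i * x i * t := fun i => by
    have := hx i; have := hU' i
    refine mul_le_mul_of_nonneg_left ?_ (by positivity)
    have : 0 ≤ x i / P.K := by positivity
    linarith
  have hμrate : ∀ i ∈ I, singleLevelRate (μ i) P.K (P.N i) (P.U i) (P.d i) * t ^ 2 ≤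
      2 * (P.U i * x i * t) := fun i hi => by
    have h1 := hμI i hi
    have := hx i; have := hU' i; have := hd' i; have := hN' i
    have h2 : 1 - P.d i * μ i / P.N i ≤ 1 := by
      have : 0 ≤ P.d i * μ i / P.N i := div_nonneg (mul_nonneg (by positivity) h1.1) (by positivity)
      linarith
    calc _ ≤ (2 * P.U i * x i / t * 1) * t ^ 2 := by
          refine mul_le_mul_of_nonneg_right (h1.2.2.trans ?_) (by positivity)
          exact mul_le_mul_of_nonneg_left h2 (by positivity)
      _ = _ := by field_simp
  -- the parameters of the converse
  obtain ⟨m, q, hm, hm', hq, hqm⟩ := exists_base_block (D := P.D) ht hD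
  have hm0 : 0 < m := by omega
  have hmK : m ≤ 2 * P.K := by
    rcases hm' with h | h
    · have h1 : m ≤ 2 * P.D := by exact_mod_cast h
      omega
    · have h1 : (m : ℝ) ≤ P.K := h.trans (by rw [div_le_iff₀ (by positivity)]; linarith)
      have h2 : m ≤ P.K := by exact_mod_cast h1
      omega
  have hmx : ∀ i ∈ I₁, (m : ℝ) ≤ x i / (2 * t) := fun i hi => by
    have h1 := not_lt.1 (Finset.mem_filter.1 hi).2
    rcases hm' with h | h
    · refine h.trans ?_
      rw [le_div_iff₀ (by positivity)]; linarith
    · refine h.trans ?_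
      have := hxt i (hI₁I hi)
      rw [div_le_div_iff₀ (by positivity) (by positivity)]
      nlinarith
  -- Each class gets a decoding window whose credit n/s, less the memory of the level, dominates a
  -- multiple of t² times its rate; on J the credit equals the memory.
  have hpar : ∀ i, ∃ s c b n e : ℕ, c ≤ P.K ∧ 2 * c + P.d i ≤ s + 2 ∧ n ≤ P.N i ∧
      n ≤ b * c * P.U i ∧
      (i ∈ J → s < m ∧ 1 ≤ s ∧ (P.N i : ℝ) / P.d i = (n : ℝ) / s ∧
        (b : ℝ) / s ≤ 2 * (x i ^ 2 / P.d i)) ∧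
      (i ∈ I₀ → s < m ∧ 1 ≤ s ∧ (b : ℝ) / s ≤ 128 * P.D * t ^ 2 ∧
        singleLevelRate (μ i) P.K (P.N i) (P.U i) (P.d i) * t ^ 2 ≤ 40 * ((n : ℝ) / s - μ i)) ∧
      (i ∈ I₁ → s = m * 2 ^ e ∧ b = q * 2 ^ e ∧ P.U i * x i * t + μ i ≤ (n : ℝ) / s) ∧
      (i ∈ H → s = m * 2 ^ e ∧ b = q * 2 ^ e ∧ (P.K * P.U i * t ^ 2 / 2 : ℝ) ≤ (n : ℝ) / s) := by
    intro i
    have hiu : i ∈ H ∪ (I₀ ∪ I₁) ∪ J := by rw [hI01', hunion]; exact Finset.mem_univ i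
    -- A window of at most x/(2t) caches gives N/s ≥ 2 U x t, and μ takes at most half of this.
    have hgain : ∀ s : ℕ, 0 < s → (s : ℝ) ≤ x i / (2 * t) →
        P.U i * x i * t + μ i ≤ (P.N i : ℝ) / s := by
      intro s hs hsx
      have hs' : (0 : ℝ) < s := by exact_mod_cast hs
      have := hx i; have := hU' i
      rw [le_div_iff₀ hs', hNx]
      calc _ ≤ (2 * (P.U i * x i * t)) * (x i / (2 * t)) := by
            have := hμt i; gcongr; linarith
        _ = _ := by field_simp
    have hsingle : ∃ s c b n : ℕ, c ≤ P.K ∧ 2 * c + P.d i ≤ s + 2 ∧ n ≤ P.N i ∧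
        n ≤ b * c * P.U i ∧ s < m ∧ 1 ≤ s ∧ (P.N i : ℝ) / P.d i = (n : ℝ) / s ∧
        (b : ℝ) / s ≤ 2 * (x i ^ 2 / P.d i) := by
      obtain ⟨b, hb1, hb2⟩ := exists_parameters_single_user (hx1 i) (hNx i)
      have := hdD i
      have := (hd i).1
      refine ⟨P.d i, 1, b, P.N i, by omega, by omega, le_rfl, hb1, by omega, by omega, rfl, ?_⟩
      rw [← mul_div_assoc]
      have := hd' i
      gcongr
    simp only [Finset.mem_union] at hiu
    rcases hiu with (hi | (hi | hi)) | hi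
    · obtain ⟨s, c, b, n, e, h1, h2, h3, h4, h5, h6, h7⟩ := exists_parameters_large ht (hdD i) hD
        (hNx i) (hHx i hi) hm hq hmK
      exact ⟨s, c, b, n, e, h1, h2, h3, h4, fun h => absurd h (Finset.disjoint_left.1 hHJ hi),
        fun h => absurd (hI₀I h) (Finset.disjoint_left.1 hHI hi),
        fun h => absurd (hI₁I h) (Finset.disjoint_left.1 hHI hi), fun _ => ⟨h5, h6, h7⟩⟩
    · have hiI := hI₀I hi
      have hnot : i ∉ J ∧ i ∉ I₁ ∧ i ∉ H := ⟨Finset.disjoint_left.1 hIJ hiI,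
        Finset.disjoint_left.1 hI01 hi, Finset.disjoint_right.1 hHI hiI⟩
      -- If x is large compared with d t, a window longer than d gives a definite surplus. Otherwise
      -- the level may be almost fully cached, and the window must be exactly the d caches of one
      -- user.
      rcases le_or_gt (8 * P.d i * t) (x i) with hcase | hcase
      · obtain ⟨s, c, b, h1, h2, h3, h4, h5, h6⟩ := exists_parameters_window ht (hx i) (hd i).1
          (hNx i) hcase (hIx i hiI) (hxt i hiI)
        have hsm : s < m := by
          have h7 : (s : ℝ) < 2 * P.D := h5.trans_lt (by
            have := (Finset.mem_filter.1 hi).2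
            rw [div_lt_iff₀ (by positivity)]; linarith)
          have h8 : s < 2 * P.D := by exact_mod_cast h7
          omega
        refine ⟨s, c, b, P.N i, 0, h1, h2, le_rfl, h3, fun h => absurd h hnot.1,
          fun _ => ⟨hsm, h4, h6.trans ?_, ?_⟩, fun h => absurd h hnot.2.1,
          fun h => absurd h hnot.2.2⟩
        · nlinarith [sq_nonneg t]
        · have h7 := hgain s h4 h5
          have h8 := hμrate i hiI
          have h9 : 0 ≤ P.U i * x i * t := by have := hx i; have := hU' i; positivity
          linarith
      · obtain ⟨s, c, b, n, h1, h2, h3, h4, h5, h6, h7, h8⟩ := hsingle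
        refine ⟨s, c, b, n, 0, h1, h2, h3, h4, fun h => absurd h hnot.1,
          fun _ => ⟨h5, h6, h8.trans ?_, ?_⟩, fun h => absurd h hnot.2.1,
          fun h => absurd h hnot.2.2⟩
        · have h9 : x i ^ 2 ≤ (8 * P.d i * t) ^ 2 := by have := hx i; gcongr
          have h10 : x i ^ 2 / P.d i ≤ 64 * P.d i * t ^ 2 := by
            rw [div_le_iff₀ (hd' i)]; linarith
          have h11 : (P.d i : ℝ) ≤ P.D := by exact_mod_cast hdD i
          have h12 : (P.d i : ℝ) * t ^ 2 ≤ P.D * t ^ 2 := by gcongr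
          linarith
        · rw [← h7]
          obtain ⟨-, h9, h10⟩ := hμI i hiI
          have := hd' i; have := hN' i; have := hx i; have := hU' i
          -- With s = d the surplus carries the same factor 1 - dμ/N as the rate, so both vanish
          -- together.
          have e1 : (P.N i : ℝ) / P.d i - μ i = P.N i / P.d i * (1 - P.d i * μ i / P.N i) := by
            field_simp
          rw [e1]
          calc _ ≤ (2 * P.U i * x i / t * (1 - P.d i * μ i / P.N i)) * t ^ 2 := by gcongr
            _ = (2 * P.U i * x i * t) * (1 - P.d i * μ i / P.N i) := by field_simp
            _ ≤ (40 * (P.N i / P.d i)) * (1 - P.d i * μ i / P.N i) := by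
                refine mul_le_mul_of_nonneg_right ?_ h9
                rw [hNx, ← mul_div_assoc, le_div_iff₀ (hd' i)]
                have h12 : 0 ≤ P.U i * x i := by positivity
                have h13 := mul_le_mul_of_nonneg_left (hIdt i hiI) h12
                nlinarith
            _ = _ := by ring
    · have hiI := hI₁I hi
      obtain ⟨s, c, b, e, h1, h2, h3, h4, h5, h6, h7⟩ := exists_parameters_nested ht (hx i) (hdD i)
        hD (hNx i) (hIx i hiI) hm hq (hmx i hi)
      exact ⟨s, c, b, P.N i, e, h1, h2, le_rfl, h3,
        fun h => absurd h (Finset.disjoint_left.1 hIJ hiI),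
        fun h => absurd hi (Finset.disjoint_left.1 hI01 h), fun _ => ⟨h5, h6, hgain s h7 h4⟩,
        fun h => absurd hiI (Finset.disjoint_left.1 hHI h)⟩
    · obtain ⟨s, c, b, n, h1, h2, h3, h4, h5⟩ := hsingle
      have hnI : i ∉ I := Finset.disjoint_right.1 hIJ hi
      exact ⟨s, c, b, n, 0, h1, h2, h3, h4, fun _ => h5, fun h => absurd (hI₀I h) hnI,
        fun h => absurd (hI₁I h) hnI, fun h => absurd hi (Finset.disjoint_left.1 hHJ h)⟩
  choose s c b n e hc hs hnN hn hparJ hparI₀ hparI₁ hparH using hpar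
  have hJI₀ : Disjoint J I₀ := (hIJ.mono_left hI₀I).symm
  have hI₁H : Disjoint I₁ H := (hHI.mono_right hI₁I).symm
  have hA : Disjoint (J ∪ I₀) (I₁ ∪ H) := by
    rw [Finset.disjoint_union_left, Finset.disjoint_union_right, Finset.disjoint_union_right]
    exact ⟨⟨(hIJ.mono_left hI₁I).symm, hHJ.symm⟩, hI01, (hHI.mono_right hI₀I).symm⟩
  have hbound := hach.bound hM hK hN s c b n hc hs hnN hn hA hm0 (q := q) e
    (fun i hi => by
      rcases Finset.mem_union.1 hi with h | h
      · exact ⟨(hparJ i h).2.1, (hparJ i h).1⟩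
      · exact ⟨(hparI₀ i h).2.1, (hparI₀ i h).1⟩)
    (fun i hi => by
      rcases Finset.mem_union.1 hi with h | h
      · exact (hparI₁ i h).1
      · exact (hparH i h).1)
    (fun i hi => by
      rcases Finset.mem_union.1 hi with h | h
      · exact (hparI₁ i h).2.1
      · exact (hparH i h).2.1)
  rw [Finset.sum_union hJI₀, Finset.sum_union hI₁H, Finset.sum_union hJI₀] at hbound
  -- the coefficient of the rate
  have hβJ : ∑ i ∈ J, (b i : ℝ) / s i ≤ 4 * P.D * t ^ 2 := by
    have h1 := sum_sq_div_le_of_separated x P.d J ht hD (fun i _ => (hx i).le)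
      (fun i _ => ⟨(hd i).1, hdD i⟩) hJx (fun i _ j _ hij hle => scale_separated hN hU hsep hij hle)
    calc _ ≤ ∑ i ∈ J, 2 * (x i ^ 2 / P.d i) := Finset.sum_le_sum fun i hi => (hparJ i hi).2.2.2
      _ = 2 * ∑ i ∈ J, x i ^ 2 / P.d i := by rw [Finset.mul_sum]
      _ ≤ _ := by linarith
  have hDt : 0 ≤ P.D * t ^ 2 := by positivity
  have hβI : ∑ i ∈ I₀, (b i : ℝ) / s i ≤ 128 * P.D * t ^ 2 := by
    calc _ ≤ I₀.card • (128 * P.D * t ^ 2) := Finset.sum_le_card_nsmul _ _ _ fun i hi =>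
          (hparI₀ i hi).2.2.1
      _ ≤ 1 * (128 * P.D * t ^ 2) := by
          rw [nsmul_eq_mul]
          have : (I₀.card : ℝ) ≤ 1 := by exact_mod_cast hI₀card
          gcongr
      _ = _ := one_mul _
  -- 4 from J, 128 from the single level of I₀, 68 from the shared block.
  have hβ : ∑ i ∈ J, (b i : ℝ) / s i + ∑ i ∈ I₀, (b i : ℝ) / s i + q / m ≤ 200 * P.D * t ^ 2 := by
    have : t ^ 2 ≤ P.D * t ^ 2 := le_mul_of_one_le_left (sq_nonneg t) hD'
    linarith
  have hβR := mul_le_mul_of_nonneg_right hβ hR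
  -- the total memory
  have hMsum : M = P.T J + ∑ i ∈ I, μ i := by
    have hS : 0 < P.S I := Finset.sum_pos (fun i _ =>
      Real.sqrt_pos.2 (mul_pos (hN' i) (hU' i))) ⟨i₀, hi₀⟩
    have h1 : t * P.S I = M - P.T J + P.V I := by rw [ht_def, tildeM, div_mul_cancel₀ _ hS.ne']
    have h2 : ∑ i ∈ I, μ i = t * P.S I - P.V I := by
      rw [S, V, Finset.mul_sum, ← Finset.sum_sub_distrib]
      refine Finset.sum_congr rfl fun i _ => ?_
      rw [sqrt_mul_eq hN hU, hNx, hμ, sharedMemory]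
      ring
    linarith
  have hgJ : P.T J = ∑ i ∈ J, (n i : ℝ) / s i :=
    Finset.sum_congr rfl fun i hi => (hparJ i hi).2.2.1
  have hgI₁ : ∑ i ∈ I₁, P.U i * x i * t + ∑ i ∈ I₁, μ i ≤ ∑ i ∈ I₁, (n i : ℝ) / s i := by
    rw [← Finset.sum_add_distrib]
    exact Finset.sum_le_sum fun i hi => (hparI₁ i hi).2.2
  rw [← hI01', Finset.sum_union hI01] at hMsum
  -- the rate of the scheme
  have hrate : P.memorySharingRate M H I J =
      ∑ i ∈ H, (P.K * P.U i : ℝ) +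
      (∑ i ∈ I₀, singleLevelRate (μ i) P.K (P.N i) (P.U i) (P.d i) +
        ∑ i ∈ I₁, singleLevelRate (μ i) P.K (P.N i) (P.U i) (P.d i)) := by
    rw [memorySharingRate, ← hunion, Finset.sum_union (Finset.disjoint_union_left.2 ⟨hHJ, hIJ⟩),
      Finset.sum_union hHI, ← Finset.sum_union hI01, hI01']
    have e1 : ∀ i ∈ H, singleLevelRate (P.allocation M H I J i) P.K (P.N i) (P.U i) (P.d i) =
        P.K * P.U i := fun i hi => by
      rw [allocation, if_pos hi, singleLevelRate_zero]
    have e2 : ∀ i ∈ I, singleLevelRate (P.allocation M H I J i) P.K (P.N i) (P.U i) (P.d i) =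
        singleLevelRate (μ i) P.K (P.N i) (P.U i) (P.d i) := fun i hi => by
      have : P.allocation M H I J i = μ i := by
        rw [allocation, if_neg (Finset.disjoint_right.1 hHI hi), if_pos hi, sqrt_mul_eq hN hU, hNx,
          hμ, sharedMemory]
        ring
      rw [this]
    have e3 : ∀ i ∈ J, singleLevelRate (P.allocation M H I J i) P.K (P.N i) (P.U i) (P.d i) = 0 :=
      fun i hi => by
        rw [allocation, if_neg (Finset.disjoint_right.1 hHJ hi),
          if_neg (Finset.disjoint_right.1 hIJ hi), singleLevelRate_full (hN i) (hd i).1]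
    rw [Finset.sum_congr rfl e1, Finset.sum_congr rfl e2, Finset.sum_congr rfl e3]
    simp
  have hrI₀ : (∑ i ∈ I₀, singleLevelRate (μ i) P.K (P.N i) (P.U i) (P.d i)) * t ^ 2 ≤
      40 * (∑ i ∈ I₀, (n i : ℝ) / s i - ∑ i ∈ I₀, μ i) := by
    rw [Finset.sum_mul, ← Finset.sum_sub_distrib, Finset.mul_sum]
    exact Finset.sum_le_sum fun i hi => (hparI₀ i hi).2.2.2
  have hrI₁ : (∑ i ∈ I₁, singleLevelRate (μ i) P.K (P.N i) (P.U i) (P.d i)) * t ^ 2 ≤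
      2 * ∑ i ∈ I₁, P.U i * x i * t := by
    rw [Finset.sum_mul, Finset.mul_sum]
    exact Finset.sum_le_sum fun i hi => hμrate i (hI₁I hi)
  have hrH : (∑ i ∈ H, (P.K * P.U i : ℝ)) * t ^ 2 ≤ 2 * ∑ i ∈ H, (n i : ℝ) / s i := by
    rw [Finset.sum_mul, Finset.mul_sum]
    exact Finset.sum_le_sum fun i hi => by linarith [(hparH i hi).2.2]
  have hpos₁ : 0 ≤ ∑ i ∈ I₁, P.U i * x i * t := Finset.sum_nonneg fun i _ => by
    have := hx i; have := hU' i; positivity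
  have hposH : 0 ≤ ∑ i ∈ H, (n i : ℝ) / s i := Finset.sum_nonneg fun i _ => by positivity
  -- The surpluses sum to at most 200 D t² R and the worst factor is 40, so 8000 D already suffices.
  have hfinal : P.memorySharingRate M H I J * t ^ 2 ≤ (9909 * P.D * R) * t ^ 2 := by
    rw [hrate, add_mul, add_mul]
    have hDRt : 0 ≤ P.D * t ^ 2 * R := mul_nonneg hDt hR
    linarith
  exact le_of_mul_le_mul_right hfinal (by positivity)

end CachingSetup

theorem mainTheorem1 {L : ℕ} (P : CachingSetup L) (hvalid : P.Valid)
    (hfiles : P.MoreFilesThanUsers) (hsep : P.LevelsSeparated) (M : ℝ) (hM : 0 ≤ M) :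
    (∃ H I J : Finset (Fin L), P.IsFeasible M H I J) ∧
    ∀ H I J : Finset (Fin L), P.IsFeasible M H I J →
      P.memorySharingRate M H I J ≤ 9909 * (P.D : ℝ) * P.optimalRate M := by
  have hL := hvalid.1
  have hU := hvalid.2.1
  have hd := hvalid.2.2
  have hK : 0 < P.K := (hd ⟨0, hL⟩).1.trans (hd ⟨0, hL⟩).2
  have hN : ∀ i, 0 < P.N i := fun i => (Nat.mul_pos hK (hU i)).trans_le (hfiles i)
  have hD : 0 < P.D := (hd ⟨0, hL⟩).1.trans (Finset.le_sup (f := P.d) (Finset.mem_univ _))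
  have hD' : (0 : ℝ) < 9909 * P.D := by
    have : (0 : ℝ) < P.D := by exact_mod_cast hD
    positivity
  refine ⟨P.exists_isFeasible hL hK hN hU (fun i => (hd i).1) hM, ?_⟩
  rintro H I J ⟨hpart, ⟨hIne, hH, hI, hJ⟩ | ⟨rfl, rfl, -⟩⟩
  · rw [← div_le_iff₀' hD']
    refine P.le_optimalRate M _ fun R hach => ?_
    rw [div_le_iff₀' hD']
    exact hach.memorySharingRate_le hvalid hfiles hsep hM hpart hIne hH hI hJ
  -- Every level is fully cached, so nothing is broadcast.
  · have h0 : P.memorySharingRate M ∅ ∅ J = 0 := Finset.sum_eq_zero fun i _ => by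
      simp only [CachingSetup.allocation, Finset.notMem_empty, if_false]
      exact CachingSetup.singleLevelRate_full (hN i) (hd i).1
    rw [h0]
    exact mul_nonneg hD'.le (P.optimalRate_nonneg M)
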